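/- Let $X$ and $Y$ be complex Hilbert spaces and let $A$, with domain $D(A)\subseteq X$, be the infinitesimal generator of a strongly continuous, exponentially stable semigroup $(T(t))_{t\ge 0}$ on $X$ (that is, $\|T(t)\|\le Me^{-\omega t}$ for all $t\ge0$, with some constants $M$ and $\omega>0$). Let $\mathcal H_\infty^-$ be the algebra of bounded analytic functions on $\mathbb C^-=\{s\in\mathbb C:\operatorname{Re}s<0\}$, with $\|g\|_\infty=\sup_{s\in\mathbb C^-}|g(s)|$. Each $g\in\mathcal H_\infty^-$ has a boundary function $g(i\omega)=\lim_{r\uparrow0}g(r+i\omega)$, defined for almost all $\omega\in\mathbb R$. Let $\mathcal H_2(X)$ be the space of Laplace transforms of functions in $L^2((0,\infty);X)$, identified with the closed subspace of $L^2(i\mathbb R;X)$ formed by their boundary functions; let $\Pi$ be the orthogonal projection of $L^2(i\mathbb R;X)$ onto $\mathcal H_2(X)$, let $\mathcal L$ be the Laplace transform, and put $$M_gf=\mathcal L^{-1}\bigl(\Pi(g\cdot\mathcal Lf)\bigr),\qquad f\in L^2((0,\infty);X).$$ The operator $g(A):D(A)\to X$ is the unique linear map, bounded for the graph norm on $D(A)$,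 such that for every $x_0\in D(A)$ $$M_g\bigl(T(\cdot)x_0\bigr)(t)=g(A)T(t)x_0\qquad\text{for almost all }t>0.$$ Let $C:D(A)\to Y$ be linear, and suppose there are constants $m_2$ and $m_1>0$ such that * (admissibility) for every $x_0\in D(A)$, $CT(\cdot)x_0\in L^2((0,\infty);Y)$ and $\int_0^\infty\|CT(t)x_0\|^2\,dt\le m_2\|x_0\|^2$; * (exact observability) for every $x_0\in X$, $\int_0^\infty\|CT(t)x_0\|^2\,dt\ge m_1\|x_0\|^2$, where for $x_0\notin D(A)$ the function $CT(\cdot)x_0$ is given by the bounded linear extension to $X$ of the map $x_0\mapsto CT(\cdot)x_0$ from $D(A)$ to $L^2((0,\infty);Y)$. Then the operators $g(A)$, $g\in\mathcal H_\infty^-$, are well defined (existence and uniqueness), every $g(A)$ extends to a bounded operator on $X$, and this extension satisfies $$\|g(A)\|\le\sqrt{\frac{m_2}{m_1}}\;\|g\|_\infty .$$ Thus $A$ has a bounded $\mathcal H_\infty^-$-calculus: the map sending $g$ to the bounded extension of $g(A)$ is a unital algebra homomorphism from $\mathcal H_\infty^-$ into the bounded operators on $X$, and for $\operatorname{Re}a>0$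 it sends $g(s)=(a-s)^{-1}$ to $(aI-A)^{-1}$. -/

import Mathlib

open MeasureTheory Filter Topology Set
open scoped NNReal ENNReal

noncomputable section

/-! ### Strongly continuous semigroups and their generators -/

/-- A strongly continuous semigroup `(T(t))_{t ≥ 0}` of bounded operators on `X`. -/
structure C0Semigroup (X : Type*) [NormedAddCommGroup X] [NormedSpace ℂ X] where
  toFun : ℝ≥0 → X →L[ℂ] X
  map_zero : toFun 0 = ContinuousLinearMap.id ℂ X
  map_add : ∀ s t : ℝ≥0, toFun (s + t) = (toFun s).comp (toFun t)
  tendsto_zero : ∀ x : X, Tendsto (fun t : ℝ≥0 => toFun t x) (𝓝[>] 0) (𝓝 x)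

namespace C0Semigroup

section Generator

variable {X : Type*} [NormedAddCommGroup X] [NormedSpace ℂ X]

/-- Exponential stability: `‖T(t)‖ ≤ M e^{-ωt}` for some `M` and some `ω > 0`. -/
def ExponentiallyStable (T : C0Semigroup X) : Prop :=
  ∃ M ω : ℝ, 0 < ω ∧ ∀ t : ℝ≥0, ‖T.toFun t‖ ≤ M * Real.exp (-(ω * t))

/-- The difference quotient `(T(h)x - x)/h`. -/
def diffQuot (T : C0Semigroup X) (x : X) (h : ℝ≥0) : X :=
  ((h : ℝ) : ℂ)⁻¹ • (T.toFun h x - x)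

/-- `y` is the right derivative at `0` of the orbit of `x`. -/
def HasGen (T : C0Semigroup X) (x y : X) : Prop :=
  Tendsto (T.diffQuot x) (𝓝[>] 0) (𝓝 y)

theorem HasGen.add {T : C0Semigroup X} {x y x' y' : X} (h : T.HasGen x y) (h' : T.HasGen x' y') :
    T.HasGen (x + x') (y + y') := by
  refine (Tendsto.add h h').congr fun t => ?_
  simp only [diffQuot, _root_.map_add, ← smul_add]
  congr 1
  abel

theorem HasGen.smul {T : C0Semigroup X} {x y : X} (c : ℂ) (h : T.HasGen x y) :
    T.HasGen (c • x) (c • y) := by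
  refine (Tendsto.const_smul h c).congr fun t => ?_
  simp only [diffQuot, map_smul, ← smul_sub]
  rw [smul_comm]

theorem HasGen.unique {T : C0Semigroup X} {x y y' : X} (h : T.HasGen x y) (h' : T.HasGen x y') :
    y = y' :=
  tendsto_nhds_unique h h'

/-- The infinitesimal generator `A` of the semigroup: its domain `D(A)` consists of the `x` for
which `lim_{h ↓ 0} (T(h)x - x)/h` exists, and `A x` is that limit. -/
def generator (T : C0Semigroup X) : X →ₗ.[ℂ] X where
  domain :=
    { carrier := {x | ∃ y, T.HasGen x y}
      zero_mem' := ⟨0, (tendsto_const_nhds (x := (0 : X))).congr fun t => by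
        simp [diffQuot]⟩
      add_mem' := by
        rintro a b ⟨y, hy⟩ ⟨z, hz⟩
        exact ⟨y + z, hy.add hz⟩
      smul_mem' := by
        rintro c a ⟨y, hy⟩
        exact ⟨c • y, hy.smul c⟩ }
  toFun :=
    { toFun := fun x => Classical.choose x.2
      map_add' := fun x x' => (Classical.choose_spec (x + x').2).unique
        ((Classical.choose_spec x.2).add (Classical.choose_spec x'.2))
      map_smul' := fun c x => (Classical.choose_spec (c • x).2).unique
        ((Classical.choose_spec x.2).smul c) }

theorem mem_domain {T : C0Semigroup X} {x : X} (t : ℝ≥0) (hx : x ∈ T.generator.domain) :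
    T.toFun t x ∈ T.generator.domain := by
  obtain ⟨y, hy⟩ := hx
  refine ⟨T.toFun t y, (((T.toFun t).continuous.tendsto y).comp hy).congr fun h => ?_⟩
  have h1 : T.toFun t (T.toFun h x) = T.toFun h (T.toFun t x) := by
    rw [← ContinuousLinearMap.comp_apply, ← ContinuousLinearMap.comp_apply, ← T.map_add,
      ← T.map_add, add_comm]
  simp only [Function.comp_apply, diffQuot, map_smul, map_sub, h1]

/-- `T(t) x` as an element of `D(A)`, for `x ∈ D(A)`. -/
def onDomain (T : C0Semigroup X) (t : ℝ≥0) (x : T.generator.domain) : T.generator.domain :=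
  ⟨T.toFun t x, mem_domain t x.2⟩

end Generator

end C0Semigroup

/-! ### Lebesgue spaces of vector-valued functions -/

/-- Lebesgue measure on the half-line `(0, ∞)`. -/
abbrev halfLine : Measure ℝ := (volume : Measure ℝ).restrict (Ioi 0)

/-- `L²((0, ∞); X)`. -/
abbrev L2Half (X : Type*) [NormedAddCommGroup X] := Lp X 2 halfLine

/-- `L²(ℝ; X)`. -/
abbrev L2Line (X : Type*) [NormedAddCommGroup X] := Lp X 2 (volume : Measure ℝ)

open Classical in
/-- The class in `L²(μ; X)` of a square-integrable function `u` (and `0` for other `u`). -/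
def toL2 {X : Type*} [NormedAddCommGroup X] (μ : Measure ℝ) (u : ℝ → X) : Lp X 2 μ :=
  if h : MemLp u 2 μ then h.toLp u else 0

namespace C0Semigroup

section Admissible

variable {X Y : Type*} [NormedAddCommGroup X] [NormedSpace ℂ X]
  [NormedAddCommGroup Y] [NormedSpace ℂ Y]

/-- The function `t ↦ C T(t) x₀` for `x₀ ∈ D(A)` (only `t > 0` matters). -/
def output (T : C0Semigroup X) (C : T.generator.domain →ₗ[ℂ] Y) (x₀ : T.generator.domain) :
    ℝ → Y :=
  fun t => C (T.onDomain t.toNNReal x₀)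

/-- `C : D(A) → Y` is an (infinite-time) admissible output operator, with admissibility
constant `m`. -/
def AdmissibleWith (T : C0Semigroup X) (C : T.generator.domain →ₗ[ℂ] Y) (m : ℝ) : Prop :=
  ∀ x₀ : T.generator.domain, MemLp (T.output C x₀) 2 halfLine ∧
    ∫ t in Ioi (0 : ℝ), ‖T.output C x₀ t‖ ^ 2 ≤ m * ‖(x₀ : X)‖ ^ 2

/-- `𝒪 : X → L²((0, ∞); Y)` is the bounded linear extension to `X` of `x₀ ↦ C T(·) x₀`,
`x₀ ∈ D(A)`. It exists if `C` is admissible, and it is unique because `D(A)` is dense. -/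
def IsOutputMap (T : C0Semigroup X) (C : T.generator.domain →ₗ[ℂ] Y) (O : X →L[ℂ] L2Half Y) :
    Prop :=
  ∀ x₀ : T.generator.domain, O (x₀ : X) =ᵐ[halfLine] T.output C x₀

/-- `(C, A)` is exactly observable with constant `m`: `∫₀^∞ ‖C T(t) x₀‖² dt ≥ m ‖x₀‖²` for all
`x₀ ∈ X`, where `C T(·) x₀` is given by the extended output map if `x₀ ∉ D(A)`. -/
def ExactlyObservableWith (T : C0Semigroup X) (C : T.generator.domain →ₗ[ℂ] Y) (m : ℝ) : Prop :=
  ∃ O : X →L[ℂ] L2Half Y, T.IsOutputMap C O ∧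
    ∀ x₀ : X, m * ‖x₀‖ ^ 2 ≤ ∫ t in Ioi (0 : ℝ), ‖O x₀ t‖ ^ 2

end Admissible

end C0Semigroup

/-! ### The algebra `H∞⁻` -/

/-- The algebra `H∞⁻` of functions that are analytic and bounded on the open left half-plane.
Its elements are functions on `ℂ` whose values outside the left half-plane are irrelevant. -/
def HInftyMinus : Subalgebra ℂ (ℂ → ℂ) where
  carrier := {g | DifferentiableOn ℂ g {s | s.re < 0} ∧ ∃ M : ℝ, ∀ s : ℂ, s.re < 0 → ‖g s‖ ≤ M}
  mul_mem' := by
    rintro f g ⟨hf, M, hM⟩ ⟨hg, N, hN⟩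
    refine ⟨hf.mul hg, M * N, fun s hs => ?_⟩
    rw [Pi.mul_apply, norm_mul]
    exact mul_le_mul (hM s hs) (hN s hs) (norm_nonneg _) ((norm_nonneg _).trans (hM s hs))
  add_mem' := by
    rintro f g ⟨hf, M, hM⟩ ⟨hg, N, hN⟩
    exact ⟨hf.add hg, M + N, fun s hs => (norm_add_le _ _).trans (add_le_add (hM s hs) (hN s hs))⟩
  algebraMap_mem' := fun c => ⟨differentiableOn_const c, ‖c‖, fun _ _ => le_rfl⟩

/-- `‖g‖_∞`, the supremum of `|g|` over the open left half-plane. -/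
def hInftyNorm (g : HInftyMinus) : ℝ := ⨆ s : {s : ℂ // s.re < 0}, ‖(g : ℂ → ℂ) s‖

/-- The boundary function `ω ↦ g(iω) = lim_{r ↑ 0} g(r + iω)` of `g`; by Fatou's theorem the limit
exists for almost all `ω`. -/
def boundaryFun (g : ℂ → ℂ) (ω : ℝ) : ℂ :=
  limUnder (𝓝[<] (0 : ℝ)) fun r : ℝ => g (r + ω * Complex.I)

/-! ### The Toeplitz operator `M_g` -/

/-- Extension by zero as a linear isometry `L²((0, ∞); X) → L²(ℝ; X)`. -/
def extendZero (X : Type*) [NormedAddCommGroup X] [NormedSpace ℂ X] :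
    L2Half X →ₗᵢ[ℂ] L2Line X where
  toFun f := ((memLp_indicator_iff_restrict measurableSet_Ioi).2 (Lp.memLp f)).toLp
    ((Ioi (0 : ℝ)).indicator f)
  map_add' f g := by
    rw [← MemLp.toLp_add]
    refine MemLp.toLp_congr _ _ ?_
    rw [← indicator_add']
    exact (ae_eq_restrict_iff_indicator_ae_eq measurableSet_Ioi).1 (Lp.coeFn_add f g)
  map_smul' c f := by
    rw [RingHom.id_apply, ← MemLp.toLp_const_smul]
    refine MemLp.toLp_congr _ _ ?_
    rw [show c • (Ioi (0 : ℝ)).indicator (f : ℝ → X) = (Ioi (0 : ℝ)).indicator (c • (f : ℝ → X))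
      from (indicator_const_smul _ c _).symm]
    exact (ae_eq_restrict_iff_indicator_ae_eq measurableSet_Ioi).1 (Lp.coeFn_smul c f)
  norm_map' f := by
    change ‖MemLp.toLp ((Ioi (0 : ℝ)).indicator (f : ℝ → X))
      ((memLp_indicator_iff_restrict measurableSet_Ioi).2 (Lp.memLp f))‖ = _
    rw [Lp.norm_toLp, eLpNorm_indicator_eq_eLpNorm_restrict measurableSet_Ioi, Lp.norm_def]

section Toeplitz

variable (X : Type*) [NormedAddCommGroup X] [InnerProductSpace ℂ X] [CompleteSpace X]

/-- The Laplace transform on `L²((0, ∞); X)`, through its boundary function on the imaginary axis: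
`f` is sent to the Fourier-Plancherel transform of its extension by zero. With the normalisation
`(𝓕 f)(ξ) = ∫ e^{-2πiξt} f(t) dt`, the value at `ξ` is `F(2πiξ)`, where
`F(s) = ∫₀^∞ e^{-st} f(t) dt`. -/
def laplace : L2Half X →ₗᵢ[ℂ] L2Line X :=
  (Lp.fourierTransformₗᵢ ℝ X).toLinearIsometry.comp (extendZero X)

/-- The Hardy space `H₂(X)`, as the closed subspace of boundary functions in `L²(ℝ; X)`. -/
def hardyTwo : Submodule ℂ (L2Line X) := LinearMap.range (laplace X).toLinearMap

instance : CompleteSpace (hardyTwo X) :=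
  ((laplace X).isometry.isUniformInducing.isComplete_range).completeSpace_coe

/-- The Laplace transform as a bijection of `L²((0, ∞); X)` onto `H₂(X)`. -/
def laplaceEquiv : L2Half X ≃ₗ[ℂ] hardyTwo X :=
  LinearEquiv.ofInjective (laplace X).toLinearMap (laplace X).injective

variable {X}

/-- The pointwise product of the boundary function of `g` and `F ∈ L²(ℝ; X)`; the boundary
variable is `s = 2πiξ`. -/
def mulBoundary (g : HInftyMinus) (F : L2Line X) : L2Line X :=
  toL2 volume fun ξ : ℝ => boundaryFun g (2 * Real.pi * ξ) • F ξ

/-- The Toeplitz operator `M_g f = 𝓛⁻¹ (Π (g F))` on `L²((0, ∞); X)`, where `F = 𝓛 f` and `Π` is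
the orthogonal projection onto `H₂(X)`. -/
def toeplitz (g : HInftyMinus) (f : L2Half X) : L2Half X :=
  (laplaceEquiv X).symm ((hardyTwo X).orthogonalProjectionOnto (mulBoundary g (laplace X f)))

/-! ### The operators `g(A)` -/

namespace C0Semigroup

/-- The orbit `T(·) x₀` in `L²((0, ∞); X)`. -/
def orbit (T : C0Semigroup X) (x₀ : X) : L2Half X :=
  toL2 halfLine fun t : ℝ => T.toFun t.toNNReal x₀

/-- The output map `𝔒_g x₀ = M_g (T(·) x₀)`. -/
def outputMapOf (T : C0Semigroup X) (g : HInftyMinus) (x₀ : X) : L2Half X :=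
  toeplitz g (T.orbit x₀)

/-- `G : D(A) → X` is linear, bounded for the graph norm of `D(A)`, and satisfies
`𝔒_g x₀ = G T(·) x₀` for all `x₀ ∈ D(A)`. -/
def Represents (T : C0Semigroup X) (g : HInftyMinus) (G : T.generator.domain →ₗ[ℂ] X) : Prop :=
  (∃ c : ℝ, ∀ x₀ : T.generator.domain, ‖G x₀‖ ≤ c * (‖(x₀ : X)‖ + ‖T.generator x₀‖)) ∧
    ∀ x₀ : T.generator.domain, T.outputMapOf g x₀ =ᵐ[halfLine] T.output G x₀

open Classical in
/-- The operator `g(A) : D(A) → X`: the unique `G` with `T.Represents g G`. -/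
def functionOfGenerator (T : C0Semigroup X) (g : HInftyMinus) : T.generator.domain →ₗ[ℂ] X :=
  if h : ∃ G, T.Represents g G then h.choose else 0

end C0Semigroup

end Toeplitz

end

/-! Let `O : X → L²((0, ∞); Y)` be the extended output map. It turns `T(τ)` into the left shift by
`τ`, which is the Toeplitz operator with symbol `exp (τ s)`. Admissibility and exact observability
give `m₁ ‖x‖² ≤ ‖O x‖² ≤ m₂ ‖x‖²`, so `O` is an isomorphism onto a closed subspace that is invariant
under left shifts. If that subspace is invariant under the Toeplitz operator `M_g` for every `g` in
`H∞⁻`, then `Φ g = O⁻¹ M_g O` is defined on all of `X`, and `‖M_g‖ ≤ ‖g‖_∞` yields the bound with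
`√(m₂ / m₁)`. The map `Φ` is multiplicative because symbols from `H∞⁻` preserve the orthogonal
complement of the Hardy space (`toep_mul`).

Invariance is an approximation argument. Bounded almost everywhere convergence of symbols implies
strong convergence of Toeplitz operators (`BddTendsto.toep`), and a closed range survives strong
limits (`isBddClosed_calculusAlgebra`). Every symbol from `H∞⁻` arises from exponentials by algebra
operations and such limits (`HInftyMinus.symbol_mem`): Riemann sums give the resolvent `(1 - s)⁻¹`,
hence the Cayley transform; Taylor polynomials in it give dilated functions on the disc; removing
the dilation gives `g (s - δ)`; and `δ ↓ 0` gives `g` by Fatou's theorem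
(`ae_exists_tendsto_boundary`).

To identify `Φ g` with `g(A)`, which is defined through the orbits `Ψ x = T(·) x` in `L²((0, ∞);
X)`, the algebra `calculusAlgebra` asks one and the same vector to lift the Toeplitz operator
through both `O` and `Ψ`. Then `Ψ (Φ g x) = M_g (Ψ x)`, and since `Φ g` commutes with `T(t)` this is
the defining relation of `g(A)`. Uniqueness follows by letting `t ↓ 0` in the graph norm. The
resolvent statement follows from bounded convergence of the symbols `(exp (h s) - 1) / h · (a -
s)⁻¹`. -/

/-! ### Essentially bounded symbols and multiplication operators -/

/-- The algebra of essentially bounded, almost everywhere strongly measurable functions `ℝ → ℂ`. -/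
def essBdd : Subalgebra ℂ (ℝ → ℂ) where
  carrier := {b | AEStronglyMeasurable b volume ∧ ∃ M : ℝ, ∀ᵐ ξ, ‖b ξ‖ ≤ M}
  mul_mem' := by
    rintro a b ⟨ha, M, hM⟩ ⟨hb, N, hN⟩
    refine ⟨ha.mul hb, M * N, ?_⟩
    filter_upwards [hM, hN] with ξ h h'
    rw [Pi.mul_apply, norm_mul]
    exact mul_le_mul h h' (norm_nonneg _) ((norm_nonneg _).trans h)
  add_mem' := by
    rintro a b ⟨ha, M, hM⟩ ⟨hb, N, hN⟩
    refine ⟨ha.add hb, M + N, ?_⟩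
    filter_upwards [hM, hN] with ξ h h'
    exact (norm_add_le _ _).trans (add_le_add h h')
  algebraMap_mem' := fun c => ⟨aestronglyMeasurable_const, ‖c‖, .of_forall fun _ => le_rfl⟩

theorem toL2_of_memLp {X : Type*} [NormedAddCommGroup X] {μ : Measure ℝ} {u : ℝ → X}
    (h : MemLp u 2 μ) : toL2 μ u = h.toLp u := dif_pos h

theorem coeFn_toL2 {X : Type*} [NormedAddCommGroup X] {μ : Measure ℝ} {u : ℝ → X}
    (h : MemLp u 2 μ) : toL2 μ u =ᵐ[μ] u := by
  rw [toL2_of_memLp h]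
  exact h.coeFn_toLp

theorem toL2_congr {X : Type*} [NormedAddCommGroup X] {μ : Measure ℝ} {u v : ℝ → X}
    (h : u =ᵐ[μ] v) : toL2 μ u = toL2 μ v := by
  by_cases hu : MemLp u 2 μ
  · rw [toL2_of_memLp hu, toL2_of_memLp ((memLp_congr_ae h).1 hu)]
    exact MemLp.toLp_congr _ _ h
  · rw [toL2, toL2, dif_neg hu, dif_neg fun hv => hu ((memLp_congr_ae h).2 hv)]

theorem Lp_norm_sq_eq_integral {X : Type*} [NormedAddCommGroup X] [InnerProductSpace ℂ X]
    {μ : Measure ℝ} (f : Lp X 2 μ) : ‖f‖ ^ 2 = ∫ t, ‖f t‖ ^ 2 ∂μ := by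
  rw [← inner_self_eq_norm_sq (𝕜 := ℂ), L2.inner_def,
    ← integral_re (L2.integrable_inner (𝕜 := ℂ) f f)]
  exact integral_congr_ae (.of_forall fun t => inner_self_eq_norm_sq (𝕜 := ℂ) (f t))

/-- The difference `v - L L* v` is orthogonal to the range of `L`, so `L L*` is the projection. This
replaces `𝓛⁻¹ Π` in the Toeplitz operator by an adjoint. -/
theorem LinearIsometry.ofInjective_symm_orthogonalProjectionOnto {E F : Type*}
    [NormedAddCommGroup E] [InnerProductSpace ℂ E] [CompleteSpace E]
    [NormedAddCommGroup F] [InnerProductSpace ℂ F] [CompleteSpace F] (L : E →ₗᵢ[ℂ] F)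
    [(LinearMap.range L.toLinearMap).HasOrthogonalProjection] (v : F) :
    (LinearEquiv.ofInjective L.toLinearMap L.injective).symm
      ((LinearMap.range L.toLinearMap).orthogonalProjectionOnto v) =
      L.toContinuousLinearMap.adjoint v := by
  rw [LinearEquiv.symm_apply_eq]
  refine Subtype.ext ?_
  refine Submodule.eq_starProjection_of_mem_of_inner_eq_zero (Subtype.prop _) ?_
  rintro _ ⟨u, rfl⟩
  have h1 := ContinuousLinearMap.adjoint_inner_left (𝕜 := ℂ) L.toContinuousLinearMap u v
  refine (inner_sub_left _ _ _).trans ?_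
  exact sub_eq_zero.2 (h1.symm.trans (L.inner_map_map _ _).symm)

section Mul

variable {X : Type*} [NormedAddCommGroup X] [InnerProductSpace ℂ X]

theorem memLp_essBdd_smul (b : essBdd) (F : L2Line X) :
    MemLp (fun ξ => (b : ℝ → ℂ) ξ • F ξ) 2 volume := by
  obtain ⟨b, hb, M, hM⟩ := b
  refine MemLp.of_le_mul (Lp.memLp F) (hb.smul (Lp.aestronglyMeasurable F)) (c := M) ?_
  filter_upwards [hM] with ξ h
  rw [norm_smul]
  exact mul_le_mul_of_nonneg_right h (norm_nonneg _)

/-- The product of a bounded symbol and a square-integrable function. -/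
noncomputable def mulFun (b : essBdd) (F : L2Line X) : L2Line X :=
  toL2 volume fun ξ => (b : ℝ → ℂ) ξ • F ξ

theorem coeFn_mulFun (b : essBdd) (F : L2Line X) :
    mulFun b F =ᵐ[volume] fun ξ => (b : ℝ → ℂ) ξ • F ξ :=
  coeFn_toL2 (memLp_essBdd_smul b F)

theorem norm_mulFun_le (b : essBdd) (F : L2Line X) {M : ℝ}
    (hM : ∀ᵐ ξ, ‖(b : ℝ → ℂ) ξ‖ ≤ M) : ‖mulFun b F‖ ≤ M * ‖F‖ := by
  refine Lp.norm_le_mul_norm_of_ae_le_mul ?_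
  filter_upwards [hM, coeFn_mulFun b F] with ξ h h'
  rw [h', norm_smul]
  exact mul_le_mul_of_nonneg_right h (norm_nonneg _)

variable (X) in
/-- Multiplication by bounded symbols, as a representation of the algebra of symbols. -/
noncomputable def mulOp : essBdd →ₐ[ℂ] (L2Line X →L[ℂ] L2Line X) where
  toFun b := LinearMap.mkContinuousOfExistsBound
    { toFun := mulFun b
      map_add' F G := by
        refine Lp.ext ?_
        filter_upwards [coeFn_mulFun b (F + G), coeFn_mulFun b F, coeFn_mulFun b G,
          Lp.coeFn_add F G, Lp.coeFn_add (mulFun b F) (mulFun b G)] with ξ h1 h2 h3 h4 h5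
        rw [h1, h4, h5, Pi.add_apply, Pi.add_apply, h2, h3, smul_add]
      map_smul' c F := by
        refine Lp.ext ?_
        filter_upwards [coeFn_mulFun b (c • F), coeFn_mulFun b F,
          Lp.coeFn_smul c F, Lp.coeFn_smul c (mulFun b F)] with ξ h1 h2 h3 h4
        rw [RingHom.id_apply, h1, h3, h4, Pi.smul_apply, Pi.smul_apply, h2, smul_comm] }
    (by
      obtain ⟨M, hM⟩ := b.2.2
      exact ⟨M, fun F => norm_mulFun_le b F hM⟩)
  map_one' := by
    ext1 F
    refine Lp.ext ((coeFn_mulFun 1 F).trans (.of_forall fun ξ => ?_))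
    exact one_smul ℂ _
  map_zero' := by
    ext1 F
    refine Lp.ext ((coeFn_mulFun 0 F).trans ?_)
    filter_upwards [Lp.coeFn_zero X 2 (volume : Measure ℝ)] with ξ h
    exact (zero_smul ℂ _).trans h.symm
  map_mul' a b := by
    ext1 F
    refine Lp.ext ?_
    change mulFun (a * b) F =ᵐ[volume] mulFun a (mulFun b F)
    filter_upwards [coeFn_mulFun (a * b) F, coeFn_mulFun b F, coeFn_mulFun a (mulFun b F)]
      with ξ h1 h2 h3
    rw [h1, h3, h2, smul_smul]
    rfl
  map_add' a b := by
    ext1 F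
    refine Lp.ext ?_
    change mulFun (a + b) F =ᵐ[volume] (mulFun a F + mulFun b F : L2Line X)
    filter_upwards [coeFn_mulFun (a + b) F, coeFn_mulFun b F, coeFn_mulFun a F,
      Lp.coeFn_add (mulFun a F) (mulFun b F)] with ξ h1 h2 h3 h4
    rw [h1, h4, Pi.add_apply, h2, h3, ← add_smul]
    rfl
  commutes' c := by
    ext1 F
    refine Lp.ext ?_
    change mulFun (algebraMap ℂ essBdd c) F =ᵐ[volume] (c • F : L2Line X)
    filter_upwards [coeFn_mulFun (algebraMap ℂ essBdd c) F, Lp.coeFn_smul c F] with ξ h1 h2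
    rw [h1, h2]
    rfl

theorem coeFn_mulOp (b : essBdd) (F : L2Line X) :
    mulOp X b F =ᵐ[volume] fun ξ => (b : ℝ → ℂ) ξ • F ξ := coeFn_mulFun b F

/-- Bounded almost everywhere convergence of symbols. -/
def BddTendsto {ι : Type*} (l : Filter ι) (b : ι → essBdd) (b₀ : essBdd) : Prop :=
  (∃ M : ℝ, ∀ᶠ i in l, ∀ᵐ ξ, ‖(b i : ℝ → ℂ) ξ‖ ≤ M) ∧
    ∀ᵐ ξ, Tendsto (fun i => (b i : ℝ → ℂ) ξ) l (𝓝 ((b₀ : ℝ → ℂ) ξ))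

/-- Dominated convergence for the squared norms, with the integrable majorant `((M + N) ‖F‖)²`. -/
theorem BddTendsto.mulOp {ι : Type*} {l : Filter ι} [l.IsCountablyGenerated]
    {b : ι → essBdd} {b₀ : essBdd} (h : BddTendsto l b b₀) (F : L2Line X) :
    Tendsto (fun i => mulOp X (b i) F) l (𝓝 (mulOp X b₀ F)) := by
  obtain ⟨⟨M, hM⟩, hlim⟩ := h
  obtain ⟨N, hN⟩ := b₀.2.2
  rw [tendsto_iff_norm_sub_tendsto_zero]
  have key : Tendsto (fun i => ∫ ξ, ‖((b i : ℝ → ℂ) ξ - (b₀ : ℝ → ℂ) ξ) • F ξ‖ ^ 2) l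
      (𝓝 (∫ _ : ℝ, (0 : ℝ))) := by
    refine tendsto_integral_filter_of_dominated_convergence
      (fun ξ => ((M + N) * ‖F ξ‖) ^ 2) ?_ ?_ ?_ ?_
    · refine .of_forall fun i => ?_
      exact (((b i).2.1.sub b₀.2.1).smul (Lp.aestronglyMeasurable F)).norm.pow 2
    · filter_upwards [hM] with i hi
      filter_upwards [hi, hN] with ξ h1 h2
      rw [Real.norm_of_nonneg (by positivity), norm_smul]
      gcongr
      exact (norm_sub_le _ _).trans (add_le_add h1 h2)
    · simp_rw [mul_pow]
      refine Integrable.const_mul ?_ _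
      exact (memLp_two_iff_integrable_sq_norm (Lp.aestronglyMeasurable F)).1 (Lp.memLp F)
    · filter_upwards [hlim] with ξ h
      have := ((h.sub_const ((b₀ : ℝ → ℂ) ξ)).smul_const (F ξ)).norm.pow 2
      simpa using this
  have h2 : ∀ i, ‖_root_.mulOp X (b i) F - _root_.mulOp X b₀ F‖ =
      √(∫ ξ, ‖((b i : ℝ → ℂ) ξ - (b₀ : ℝ → ℂ) ξ) • F ξ‖ ^ 2) := by
    intro i
    rw [← sub_apply, ← map_sub, ← Real.sqrt_sq (norm_nonneg _),
      Lp_norm_sq_eq_integral]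
    congr 1
    refine integral_congr_ae ?_
    filter_upwards [coeFn_mulOp (b i - b₀) F] with ξ h
    rw [h]
    rfl
  simp_rw [h2]
  simpa [Function.comp_def] using (Real.continuous_sqrt.tendsto _).comp key

end Mul

/-! ### Translations and the Toeplitz operators with bounded symbols -/

/-- The symbol of the translation by `τ`, the boundary function of `s ↦ exp (τ s)`. -/
noncomputable def expSymbol (τ : ℝ) : essBdd :=
  ⟨fun ξ => Complex.exp (τ * (2 * Real.pi * ξ * Complex.I)), by
    refine ⟨(by fun_prop : Continuous _).aestronglyMeasurable, 1, .of_forall fun ξ => ?_⟩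
    change ‖Complex.exp (τ * (2 * Real.pi * ξ * Complex.I))‖ ≤ 1
    rw [show (τ : ℂ) * (2 * Real.pi * ξ * Complex.I) =
      ((τ * (2 * Real.pi * ξ) : ℝ) : ℂ) * Complex.I by push_cast; ring,
      Complex.norm_exp_ofReal_mul_I]⟩

theorem expSymbol_apply (τ ξ : ℝ) :
    (expSymbol τ : ℝ → ℂ) ξ = Complex.exp (τ * (2 * Real.pi * ξ * Complex.I)) := rfl

section Toeplitz

variable (X : Type*) [NormedAddCommGroup X] [InnerProductSpace ℂ X] [CompleteSpace X]

/-- Translation `h ↦ h(· + τ)` on `L²(ℝ; X)`. -/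
noncomputable def translateL2 (τ : ℝ) : L2Line X →ₗᵢ[ℂ] L2Line X :=
  Lp.compMeasurePreservingₗᵢ ℂ (fun t => t + τ) (measurePreserving_add_right volume τ)

variable {X}

omit [CompleteSpace X] in
theorem coeFn_translateL2 (τ : ℝ) (h : L2Line X) :
    translateL2 X τ h =ᵐ[volume] fun t => h (t + τ) :=
  Lp.coeFn_compMeasurePreserving h (measurePreserving_add_right volume τ)

/-- Both sides are continuous in `h`, and on the dense Schwartz functions this is the shift rule for
the Fourier integral. -/
theorem fourier_translateL2 (τ : ℝ) (h : L2Line X) :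
    Lp.fourierTransformₗᵢ ℝ X (translateL2 X τ h) =
      mulOp X (expSymbol τ) (Lp.fourierTransformₗᵢ ℝ X h) := by
  refine DenseRange.induction_on
    (p := fun h => Lp.fourierTransformₗᵢ ℝ X (translateL2 X τ h) =
      mulOp X (expSymbol τ) (Lp.fourierTransformₗᵢ ℝ X h))
    (SchwartzMap.denseRange_toLpCLM (E := ℝ) (F := X) (p := 2) (μ := volume)
      ENNReal.ofNat_ne_top) h ?_ ?_
  · exact isClosed_eq
      ((Lp.fourierTransformₗᵢ ℝ X).continuous.comp (translateL2 X τ).continuous)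
      ((mulOp X (expSymbol τ)).continuous.comp (Lp.fourierTransformₗᵢ ℝ X).continuous)
  · intro f
    have h1 : translateL2 X τ (f.toLp 2) = (SchwartzMap.compSubConstCLM ℂ (-τ) f).toLp 2 := by
      refine Lp.ext ?_
      have h2 := (measurePreserving_add_right (volume : Measure ℝ) τ).quasiMeasurePreserving.ae
        (f.coeFn_toLp 2 volume)
      filter_upwards [coeFn_translateL2 τ (f.toLp 2), h2,
        (SchwartzMap.compSubConstCLM ℂ (-τ) f).coeFn_toLp 2 volume] with t h3 h4 h5
      rw [h3, h4, h5, SchwartzMap.compSubConstCLM_apply, sub_neg_eq_add]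
    have h6 (k : SchwartzMap ℝ X) : Lp.fourierTransformₗᵢ ℝ X (k.toLp 2) =
        (FourierTransform.fourier k).toLp 2 := SchwartzMap.toLp_fourier_eq k
    rw [SchwartzMap.toLpCLM_apply, h1, h6, h6]
    refine Lp.ext ?_
    filter_upwards [coeFn_mulOp (expSymbol τ) ((FourierTransform.fourier f).toLp 2),
      (FourierTransform.fourier f).coeFn_toLp 2 volume,
      (FourierTransform.fourier (SchwartzMap.compSubConstCLM ℂ (-τ) f)).coeFn_toLp 2 volume]
      with ξ h3 h4 h5
    rw [h3, h4, h5, SchwartzMap.fourier_coe, SchwartzMap.fourier_coe]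
    have h7 : ⇑(SchwartzMap.compSubConstCLM ℂ (-τ) f) = ⇑f ∘ fun v => v + τ := by
      ext t
      simp
    rw [h7, Real.fourier_eq, Real.fourier_eq]
    have h8 := congrFun (VectorFourier.fourierIntegral_comp_add_right Real.fourierChar volume
      (innerₗ ℝ) (f : ℝ → X) τ) ξ
    refine h8.trans ?_
    rw [Circle.smul_def, expSymbol_apply, Real.fourierChar_apply]
    congr 2
    simp
    ring

variable (X) in
/-- The adjoint of the Laplace transform `L²((0, ∞); X) → L²(ℝ; X)`. -/
noncomputable def laplaceAdj : L2Line X →L[ℂ] L2Half X :=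
  (laplace X).toContinuousLinearMap.adjoint

theorem laplaceAdj_laplace (f : L2Half X) : laplaceAdj X (laplace X f) = f := by
  refine ext_inner_left ℂ fun u => ?_
  rw [laplaceAdj, ContinuousLinearMap.adjoint_inner_right]
  exact (laplace X).inner_map_map u f

theorem norm_laplaceAdj_le (F : L2Line X) : ‖laplaceAdj X F‖ ≤ ‖F‖ := by
  refine (ContinuousLinearMap.le_opNorm _ _).trans (mul_le_of_le_one_left (norm_nonneg _) ?_)
  rw [laplaceAdj, LinearIsometryEquiv.norm_map]
  exact (laplace X).norm_toContinuousLinearMap_le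

omit [CompleteSpace X] in
theorem coeFn_extendZero (f : L2Half X) :
    extendZero X f =ᵐ[volume] (Ioi (0 : ℝ)).indicator f := by
  have h : extendZero X f = MemLp.toLp ((Ioi (0 : ℝ)).indicator f)
    ((memLp_indicator_iff_restrict measurableSet_Ioi).2 (Lp.memLp f)) := rfl
  rw [h]
  exact MemLp.coeFn_toLp _

/-- The Fourier transform is unitary, so the adjoint of "extend by zero, then transform" is
"transform back, then restrict to the half-line". -/
theorem coeFn_laplaceAdj_fourier (h : L2Line X) :
    laplaceAdj X (Lp.fourierTransformₗᵢ ℝ X h) =ᵐ[halfLine] h := by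
  have h1 : laplaceAdj X (Lp.fourierTransformₗᵢ ℝ X h) =
      LpToLpRestrictCLM ℝ X ℂ volume 2 (Ioi 0) h := by
    refine ext_inner_left ℂ fun u => ?_
    rw [laplaceAdj, ContinuousLinearMap.adjoint_inner_right]
    refine ((Lp.fourierTransformₗᵢ ℝ X).inner_map_map (extendZero X u) h).trans ?_
    rw [L2.inner_def, L2.inner_def]
    rw [show (∫ t, inner ℂ (u t) (LpToLpRestrictCLM ℝ X ℂ volume 2 (Ioi 0) h t) ∂halfLine)
      = ∫ t in Ioi 0, inner ℂ (u t) (h t) from integral_congr_ae (by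
        filter_upwards [LpToLpRestrictCLM_coeFn ℂ (Ioi 0) h] with t ht
        rw [ht]), ← integral_indicator measurableSet_Ioi]
    refine integral_congr_ae ?_
    filter_upwards [coeFn_extendZero u] with t ht
    rw [ht]
    by_cases hmem : t ∈ Ioi (0 : ℝ)
    · simp only [indicator_of_mem hmem]
    · simp only [indicator_of_notMem hmem, inner_zero_left]
  rw [h1]
  exact LpToLpRestrictCLM_coeFn ℂ (Ioi 0) h

variable (X) in
/-- The Toeplitz operator on `L²((0, ∞); X)` with a bounded symbol. -/
noncomputable def toep (b : essBdd) : L2Half X →L[ℂ] L2Half X :=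
  (laplaceAdj X).comp ((mulOp X b).comp (laplace X).toContinuousLinearMap)

theorem toep_apply (b : essBdd) (f : L2Half X) :
    toep X b f = laplaceAdj X (mulOp X b (laplace X f)) := rfl

theorem toep_one (f : L2Half X) : toep X 1 f = f := by
  rw [toep_apply, map_one, one_apply_eq_self, laplaceAdj_laplace]

theorem toep_add (a b : essBdd) (f : L2Half X) :
    toep X (a + b) f = toep X a f + toep X b f := by
  simp only [toep_apply, map_add, add_apply]

theorem toep_smul (c : ℂ) (b : essBdd) (f : L2Half X) :
    toep X (c • b) f = c • toep X b f := by
  simp only [toep_apply, map_smul, smul_apply]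

theorem norm_toep_le (b : essBdd) (f : L2Half X) {M : ℝ}
    (hM : ∀ᵐ ξ, ‖(b : ℝ → ℂ) ξ‖ ≤ M) : ‖toep X b f‖ ≤ M * ‖f‖ :=
  (norm_laplaceAdj_le _).trans ((norm_mulFun_le b _ hM).trans_eq
    (congrArg (M * ·) ((laplace X).norm_map f)))

theorem BddTendsto.toep {ι : Type*} {l : Filter ι} [l.IsCountablyGenerated]
    {b : ι → essBdd} {b₀ : essBdd} (h : BddTendsto l b b₀) (f : L2Half X) :
    Tendsto (fun i => toep X (b i) f) l (𝓝 (toep X b₀ f)) :=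
  ((laplaceAdj X).continuous.tendsto _).comp (h.mulOp _)

omit [CompleteSpace X] in
theorem extendZero_ae (f : L2Half X) : ∀ᵐ t, 0 < t → extendZero X f t = f t := by
  filter_upwards [coeFn_extendZero f] with t ht h0
  rw [ht, indicator_of_mem (show t ∈ Ioi (0 : ℝ) from h0)]

theorem coeFn_toep_expSymbol {τ : ℝ} (hτ : 0 ≤ τ) (f : L2Half X) :
    toep X (expSymbol τ) f =ᵐ[halfLine] fun t => f (t + τ) := by
  have h1 : toep X (expSymbol τ) f =
      laplaceAdj X (Lp.fourierTransformₗᵢ ℝ X (translateL2 X τ (extendZero X f))) := by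
    rw [fourier_translateL2]
    rfl
  rw [h1]
  refine (coeFn_laplaceAdj_fourier _).trans ?_
  rw [EventuallyEq, ae_restrict_iff' measurableSet_Ioi]
  filter_upwards [coeFn_translateL2 τ (extendZero X f),
    (measurePreserving_add_right (volume : Measure ℝ) τ).quasiMeasurePreserving.ae
      (extendZero_ae f)] with t h2 h3 ht
  rw [h2, h3 (add_pos_of_pos_of_nonneg ht hτ)]

/-! ### Symbols that preserve the orthogonal complement of the Hardy space -/

variable (X) in
/-- The symbols whose multiplication operator leaves the orthogonal complement of the Hardy space
invariant. -/
def antiHardy : Subalgebra ℂ essBdd where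
  carrier := {b | ∀ F : L2Line X, laplaceAdj X F = 0 → laplaceAdj X (mulOp X b F) = 0}
  mul_mem' := by
    intro a b ha hb F hF
    rw [map_mul]
    exact ha _ (hb _ hF)
  add_mem' := by
    intro a b ha hb F hF
    rw [map_add, add_apply, map_add, ha F hF, hb F hF, add_zero]
  algebraMap_mem' := by
    intro c F hF
    rw [AlgHom.commutes, Algebra.algebraMap_eq_smul_one, smul_apply, map_smul,
      one_apply_eq_self, hF, smul_zero]

theorem BddTendsto.mem_antiHardy {b : ℕ → essBdd} {b₀ : essBdd} (h : BddTendsto atTop b b₀)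
    (hb : ∀ n, b n ∈ antiHardy X) : b₀ ∈ antiHardy X := fun F hF => by
  refine tendsto_nhds_unique (((laplaceAdj X).continuous.tendsto _).comp (h.mulOp F))
    (tendsto_const_nhds.congr fun n => ?_)
  exact (hb n F hF).symm

/-- On the time side the complement consists of the functions vanishing on `(0, ∞)`, and a shift to
the left keeps them vanishing there. -/
theorem expSymbol_mem_antiHardy {τ : ℝ} (hτ : 0 ≤ τ) : expSymbol τ ∈ antiHardy X := by
  intro F hF
  obtain ⟨h, rfl⟩ := (Lp.fourierTransformₗᵢ ℝ X).surjective F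
  rw [← fourier_translateL2]
  refine Lp.ext ((coeFn_laplaceAdj_fourier _).trans
    (EventuallyEq.trans ?_ (Lp.coeFn_zero X 2 halfLine).symm))
  have h1 : (h : ℝ → X) =ᵐ[halfLine] 0 := by
    refine (coeFn_laplaceAdj_fourier h).symm.trans ?_
    rw [hF]
    exact Lp.coeFn_zero X 2 halfLine
  rw [EventuallyEq, ae_restrict_iff' measurableSet_Ioi] at h1 ⊢
  filter_upwards [coeFn_translateL2 τ h,
    (measurePreserving_add_right (volume : Measure ℝ) τ).quasiMeasurePreserving.ae h1]
    with t h2 h3 ht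
  rw [h2, h3 (add_pos_of_pos_of_nonneg ht hτ)]
  rfl

/-- The two sides differ by `a` acting on the part of `b · 𝓛 f` that the projection discards; this
part stays in the complement and is projected to `0`. -/
theorem toep_mul {a : essBdd} (ha : a ∈ antiHardy X) (b : essBdd) (f : L2Half X) :
    toep X (a * b) f = toep X a (toep X b f) := by
  simp only [toep_apply]
  rw [map_mul, mul_apply_eq_comp, ← sub_eq_zero, ← map_sub, ← map_sub]
  refine ha _ ?_
  rw [map_sub, laplaceAdj_laplace, sub_self]

theorem laplaceEquiv_symm_orthogonalProjectionOnto (F : L2Line X) :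
    (laplaceEquiv X).symm ((hardyTwo X).orthogonalProjectionOnto F) = laplaceAdj X F :=
  haveI : (LinearMap.range (laplace X).toLinearMap).HasOrthogonalProjection :=
    inferInstanceAs (hardyTwo X).HasOrthogonalProjection
  (laplace X).ofInjective_symm_orthogonalProjectionOnto F

end Toeplitz

/-! ### The Cayley transform between the unit disc and the left half-plane -/

/-- The Cayley transform of the unit disc onto the left half-plane. -/
noncomputable def discToPlane (w : ℂ) : ℂ := (w - 1) / (w + 1)

/-- The inverse Cayley transform, of the left half-plane onto the unit disc. -/
noncomputable def planeToDisc (s : ℂ) : ℂ := (1 + s) / (1 - s)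

theorem one_sub_ne_zero_of_re_nonpos {s : ℂ} (hs : s.re ≤ 0) : 1 - s ≠ 0 := by
  intro h
  have := congrArg Complex.re h
  simp at this
  linarith

theorem discToPlane_planeToDisc {s : ℂ} (hs : s.re ≤ 0) : discToPlane (planeToDisc s) = s := by
  have h := one_sub_ne_zero_of_re_nonpos hs
  rw [discToPlane, planeToDisc]
  have h1 : (1 + s) / (1 - s) + 1 = 2 / (1 - s) := by field_simp; ring
  have h2 : (1 + s) / (1 - s) - 1 = 2 * s / (1 - s) := by field_simp; ring
  rw [h1, h2]
  field_simp

theorem planeToDisc_add_one {s : ℂ} (hs : s.re ≤ 0) : planeToDisc s + 1 = 2 / (1 - s) := by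
  have h := one_sub_ne_zero_of_re_nonpos hs
  rw [planeToDisc]
  field_simp
  ring

theorem norm_one_sub_sq_sub (s : ℂ) : ‖1 - s‖ ^ 2 = ‖1 + s‖ ^ 2 - 4 * s.re := by
  rw [Complex.sq_norm, Complex.sq_norm, Complex.normSq_apply, Complex.normSq_apply]
  simp
  ring

theorem norm_planeToDisc_lt_one {s : ℂ} (hs : s.re < 0) : ‖planeToDisc s‖ < 1 := by
  have h := one_sub_ne_zero_of_re_nonpos hs.le
  rw [planeToDisc, norm_div, div_lt_one (norm_pos_iff.2 h)]
  refine lt_of_pow_lt_pow_left₀ 2 (norm_nonneg _) ?_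
  rw [norm_one_sub_sq_sub s]
  linarith

theorem norm_planeToDisc_le_one {s : ℂ} (hs : s.re ≤ 0) : ‖planeToDisc s‖ ≤ 1 := by
  have h := one_sub_ne_zero_of_re_nonpos hs
  rw [planeToDisc, norm_div, div_le_one (norm_pos_iff.2 h)]
  refine le_of_sq_le_sq ?_ (norm_nonneg _)
  rw [norm_one_sub_sq_sub s]
  linarith

theorem discToPlane_re (w : ℂ) : (discToPlane w).re = (‖w‖ ^ 2 - 1) / ‖w + 1‖ ^ 2 := by
  rw [discToPlane, Complex.div_re, Complex.sq_norm, Complex.sq_norm, Complex.normSq_apply w]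
  simp
  ring

theorem add_one_ne_zero_of_norm_lt {w : ℂ} (hw : ‖w‖ < 1) : w + 1 ≠ 0 := by
  intro h
  rw [eq_neg_of_add_eq_zero_left h] at hw
  simp at hw

theorem discToPlane_re_neg {w : ℂ} (hw : ‖w‖ < 1) : (discToPlane w).re < 0 := by
  rw [discToPlane_re]
  refine div_neg_of_neg_of_pos ?_ (pow_pos (norm_pos_iff.2 (add_one_ne_zero_of_norm_lt hw)) 2)
  nlinarith [norm_nonneg w]

theorem discToPlane_re_nonpos {w : ℂ} (hw : ‖w‖ ≤ 1) : (discToPlane w).re ≤ 0 := by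
  rw [discToPlane_re]
  refine div_nonpos_of_nonpos_of_nonneg ?_ (by positivity)
  nlinarith [norm_nonneg w]

theorem hasDerivAt_discToPlane {w : ℂ} (hw : w + 1 ≠ 0) :
    HasDerivAt discToPlane (2 / (w + 1) ^ 2) w := by
  have h := ((hasDerivAt_id w).sub_const 1).div ((hasDerivAt_id w).add_const 1) hw
  refine h.congr_deriv ?_
  simp only [id]
  congr 1
  ring

theorem hasDerivAt_planeToDisc {s : ℂ} (hs : s.re ≤ 0) :
    HasDerivAt planeToDisc (2 / (1 - s) ^ 2) s := by
  have h := ((hasDerivAt_id s).const_add 1).div ((hasDerivAt_id s).const_sub 1)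
    (one_sub_ne_zero_of_re_nonpos hs)
  refine h.congr_deriv ?_
  simp only [id]
  congr 1
  ring

/-! ### Fatou's theorem on horizontal limits -/

theorem isOpen_re_neg : IsOpen {s : ℂ | s.re < 0} := isOpen_lt Complex.continuous_re continuous_const

/-- Primitives exist on a disc, so `g(s) ds` is pulled back by the Cayley transform; `2 / (w + 1) ^
2` is its derivative. -/
theorem exists_primitive_of_re_neg {g : ℂ → ℂ} (hg : DifferentiableOn ℂ g {s | s.re < 0}) :
    ∃ G : ℂ → ℂ, ∀ s : ℂ, s.re < 0 → HasDerivAt G (g s) s := by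
  have hd : DifferentiableOn ℂ (fun w => g (discToPlane w) * (2 / (w + 1) ^ 2))
      (Metric.ball 0 1) := by
    intro w hw
    have hw1 : ‖w‖ < 1 := by simpa using hw
    have h0 := add_one_ne_zero_of_norm_lt hw1
    have h1 : DifferentiableAt ℂ g (discToPlane w) :=
      hg.differentiableAt (isOpen_re_neg.mem_nhds (discToPlane_re_neg hw1))
    have h2 : DifferentiableAt ℂ (fun w : ℂ => 2 / (w + 1) ^ 2) w :=
      (differentiableAt_const _).div (by fun_prop) (pow_ne_zero 2 h0)
    exact ((h1.comp w (hasDerivAt_discToPlane h0).differentiableAt).mul h2).differentiableWithinAt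
  obtain ⟨F, hF⟩ := hd.isExactOn_ball
  refine ⟨F ∘ planeToDisc, fun s hs => ?_⟩
  have h0 := one_sub_ne_zero_of_re_nonpos hs.le
  refine ((hF (planeToDisc s) (by simpa using norm_planeToDisc_lt_one hs)).comp s
    (hasDerivAt_planeToDisc hs.le)).congr_deriv ?_
  change g (discToPlane (planeToDisc s)) * (2 / (planeToDisc s + 1) ^ 2) * (2 / (1 - s) ^ 2) = g s
  rw [discToPlane_planeToDisc hs.le, planeToDisc_add_one hs.le]
  field_simp

/-- Boundedness of `g` makes the primitive Lipschitz on the convex half-plane. A Lipschitz extension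
to `ℂ` supplies its values on the imaginary axis; the constant may grow. -/
theorem exists_lipschitz_primitive {g : ℂ → ℂ} (hg : DifferentiableOn ℂ g {s | s.re < 0}) {M : ℝ}
    (hM : ∀ s : ℂ, s.re < 0 → ‖g s‖ ≤ M) :
    ∃ (K : ℝ≥0) (G : ℂ → ℂ), LipschitzWith K G ∧
      ∀ s : ℂ, s.re < 0 → HasDerivAt G (g s) s := by
  obtain ⟨G, hG⟩ := exists_primitive_of_re_neg hg
  have hconv : Convex ℝ {s : ℂ | s.re < 0} := convex_halfSpace_re_lt 0
  have hlip : LipschitzOnWith M.toNNReal G {s : ℂ | s.re < 0} :=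
    hconv.lipschitzOnWith_of_nnnorm_hasDerivWithin_le
      (fun s hs => (hG s hs).hasDerivWithinAt)
      (fun s hs => by
        rw [← NNReal.coe_le_coe, coe_nnnorm]
        exact (hM s hs).trans (Real.le_coe_toNNReal M))
  obtain ⟨G', hG', heq⟩ := hlip.extend_finite_dimension
  refine ⟨_, G', hG', fun s hs => (hG s hs).congr_of_eventuallyEq ?_⟩
  filter_upwards [isOpen_re_neg.mem_nhds hs] with z hz
  exact (heq hz).symm

/-! ### Cauchy estimates and the passage to the boundary -/

theorem norm_circleIntegral_le_integral_norm (f : ℂ → ℂ) :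
    ‖∮ z in C(0, 1), f z‖ ≤ ∫ θ in (0 : ℝ)..2 * Real.pi, ‖f (circleMap 0 1 θ)‖ := by
  rw [circleIntegral]
  refine (intervalIntegral.norm_integral_le_integral_norm Real.two_pi_pos.le).trans_eq ?_
  refine intervalIntegral.integral_congr fun θ _ => ?_
  simp

theorem norm_value_deriv_le_integral_norm {k : ℂ → ℂ} (hk : DiffContOnCl ℂ k (Metric.ball 0 1)) :
    ‖k 0‖ ≤ ∫ θ in (0 : ℝ)..2 * Real.pi, ‖k (circleMap 0 1 θ)‖ ∧
      ‖deriv k 0‖ ≤ ∫ θ in (0 : ℝ)..2 * Real.pi, ‖k (circleMap 0 1 θ)‖ := by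
  have hpi : 1 ≤ ‖(2 * Real.pi * Complex.I : ℂ)‖ := by
    have : ‖(2 * Real.pi * Complex.I : ℂ)‖ = 2 * Real.pi := by
      simp [abs_of_pos Real.pi_pos]
    rw [this]
    linarith [Real.pi_gt_three]
  have key : ∀ n : ℕ, ‖∮ z in C(0, 1), (1 / (z - 0) ^ (n + 1)) • k z‖ ≤
      ∫ θ in (0 : ℝ)..2 * Real.pi, ‖k (circleMap 0 1 θ)‖ := by
    intro n
    refine (norm_circleIntegral_le_integral_norm _).trans_eq ?_
    refine intervalIntegral.integral_congr fun θ _ => ?_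
    simp
  have h1 := key 0
  have h2 := key 1
  rw [hk.circleIntegral_one_div_sub_center_pow_smul one_pos, norm_smul] at h1 h2
  simp only [Nat.factorial, iteratedDeriv_zero, iteratedDeriv_one, Nat.cast_one, div_one, mul_one,
    Nat.succ_eq_add_one, zero_add] at h1 h2
  exact ⟨(le_mul_of_one_le_left (norm_nonneg _) hpi).trans h1,
    (le_mul_of_one_le_left (norm_nonneg _) hpi).trans h2⟩

theorem norm_discToPlane_mul_sq_le (w : ℂ) :
    ‖discToPlane w‖ * ‖w + 1‖ ^ 2 ≤ ‖w - 1‖ * ‖w + 1‖ := by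
  by_cases h : w + 1 = 0
  · simp [h]
  · have := norm_pos_iff.2 h
    rw [discToPlane, norm_div]
    field_simp
    exact le_rfl

/-- The auxiliary function on the disc whose Cauchy integrals control `H` near `0`. -/
noncomputable def rescaled (H : ℂ → ℂ) (y : ℝ) (w : ℂ) : ℂ :=
  H (y * discToPlane w) * (w + 1) ^ 2 / y

theorem norm_rescaled_le {H : ℂ → ℂ} {K : ℝ≥0} (hH : LipschitzWith K H) (h0 : H 0 = 0) {y : ℝ}
    (hy : 0 < y) (w : ℂ) : ‖rescaled H y w‖ ≤ K * (‖w - 1‖ * ‖w + 1‖) := by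
  have h1 : ‖H (y * discToPlane w)‖ ≤ K * (y * ‖discToPlane w‖) := by
    have := hH.dist_le_mul (y * discToPlane w) 0
    rwa [h0, dist_zero_right, dist_zero_right, norm_mul, Complex.norm_of_nonneg hy.le] at this
  rw [rescaled, norm_div, norm_mul, norm_pow, Complex.norm_of_nonneg hy.le, div_le_iff₀ hy]
  calc ‖H (y * discToPlane w)‖ * ‖w + 1‖ ^ 2
      ≤ K * (y * ‖discToPlane w‖) * ‖w + 1‖ ^ 2 := by gcongr
    _ = K * (‖discToPlane w‖ * ‖w + 1‖ ^ 2) * y := by ring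
    _ ≤ K * (‖w - 1‖ * ‖w + 1‖) * y := by
      exact mul_le_mul_of_nonneg_right
        (mul_le_mul_of_nonneg_left (norm_discToPlane_mul_sq_le w) K.2) hy.le

/-- The point `w = -1` corresponds to infinity, where `H` grows at most linearly; the double zero of
`(w + 1) ^ 2` beats this simple pole. -/
theorem continuous_rescaled {H : ℂ → ℂ} {K : ℝ≥0} (hH : LipschitzWith K H) (h0 : H 0 = 0) {y : ℝ}
    (hy : 0 < y) : Continuous (rescaled H y) := by
  rw [continuous_iff_continuousAt]
  intro w
  by_cases hw : w + 1 = 0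
  · have hv : rescaled H y w = 0 := by simp [rescaled, hw]
    rw [ContinuousAt, hv]
    refine squeeze_zero_norm (norm_rescaled_le hH h0 hy) ?_
    have : Continuous fun w : ℂ => (K : ℝ) * (‖w - 1‖ * ‖w + 1‖) := by fun_prop
    simpa [hw] using this.tendsto w
  · have h1 : ContinuousAt discToPlane w := (hasDerivAt_discToPlane hw).continuousAt
    have h2 : ContinuousAt (fun w => H (y * discToPlane w)) w :=
      ContinuousAt.comp (f := fun w => (y : ℂ) * discToPlane w) hH.continuous.continuousAt
        (continuousAt_const.mul h1)
    exact (h2.mul (by fun_prop)).div_const _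

theorem hasDerivAt_rescaled {H h : ℂ → ℂ} (hd : ∀ s : ℂ, s.re < 0 → HasDerivAt H (h s) s) {y : ℝ}
    (hy : 0 < y) {w : ℂ} (hw : ‖w‖ < 1) :
    HasDerivAt (rescaled H y) ((h (y * discToPlane w) * (y * (2 / (w + 1) ^ 2)) * (w + 1) ^ 2 +
      H (y * discToPlane w) * (2 * (w + 1))) / y) w := by
  have hne := add_one_ne_zero_of_norm_lt hw
  have hre : ((y : ℂ) * discToPlane w).re < 0 := by
    rw [Complex.re_ofReal_mul]
    exact mul_neg_of_pos_of_neg hy (discToPlane_re_neg hw)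
  have h1 : HasDerivAt (fun w => H (y * discToPlane w))
      (h (y * discToPlane w) * (y * (2 / (w + 1) ^ 2))) w :=
    HasDerivAt.comp (h := fun w => (y : ℂ) * discToPlane w) w (hd _ hre)
      ((hasDerivAt_discToPlane hne).const_mul _)
  have h2 : HasDerivAt (fun w : ℂ => (w + 1) ^ 2) (2 * (w + 1)) w := by
    refine (((hasDerivAt_id w).add_const 1).pow 2).congr_deriv ?_
    simp
  exact (h1.mul h2).div_const _

/-- Vanishing of the tangential derivative at `0` makes `H (y s) / y` tend to `0` at each `s` on the
axis. Dominated convergence on the circle and the Cauchy estimates at the centre, which corresponds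
to `s = -1`, carry this to `h` at `-y`. -/
theorem tendsto_deriv_of_hasDerivAt_zero {H h : ℂ → ℂ} {K : ℝ≥0} (hH : LipschitzWith K H)
    (h0 : H 0 = 0) (hd : ∀ s : ℂ, s.re < 0 → HasDerivAt H (h s) s)
    (ho : HasDerivAt (fun t : ℝ => H (t * Complex.I)) 0 0) :
    Tendsto (fun r : ℝ => h r) (𝓝[<] 0) (𝓝 0) := by
  have hint : Tendsto (fun r : ℝ => ∫ θ in (0 : ℝ)..2 * Real.pi,
      ‖rescaled H (-r) (circleMap 0 1 θ)‖) (𝓝[<] 0) (𝓝 (∫ θ in (0 : ℝ)..2 * Real.pi, (0 : ℝ))) := by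
    refine intervalIntegral.tendsto_integral_filter_of_dominated_convergence
      (fun _ => (K : ℝ) * (2 * 2)) ?_ ?_ ?_ ?_
    · filter_upwards [self_mem_nhdsWithin] with r hr
      exact ((continuous_rescaled hH h0 (neg_pos.2 hr)).comp
        (continuous_circleMap 0 1)).norm.aestronglyMeasurable
    · filter_upwards [self_mem_nhdsWithin] with r hr
      refine .of_forall fun θ _ => ?_
      rw [norm_norm]
      refine (norm_rescaled_le hH h0 (neg_pos.2 hr) _).trans ?_
      have h1 : ‖circleMap 0 1 θ‖ = 1 := by simp
      gcongr
      · refine (norm_sub_le _ _).trans_eq ?_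
        rw [h1, norm_one]
        norm_num
      · refine (norm_add_le _ _).trans_eq ?_
        rw [h1, norm_one]
        norm_num
    · exact intervalIntegrable_const
    · refine .of_forall fun θ _ => ?_
      set w := circleMap 0 1 θ with hwdef
      have hw1 : ‖w‖ = 1 := by simp [hwdef]
      -- This includes `w = -1`, where division by zero gives the value `0`, also a point of the
      -- axis.
      obtain ⟨t, ht⟩ : ∃ t : ℝ, discToPlane w = t * Complex.I := by
        refine ⟨(discToPlane w).im, Complex.ext ?_ ?_⟩
        · rw [discToPlane_re, hw1]
          simp
        · simp
      have h1 : Tendsto (fun r : ℝ => H (((-r * t : ℝ) : ℂ) * Complex.I) / ((-r : ℝ) : ℂ))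
          (𝓝[<] 0) (𝓝 0) := by
        have h2 : HasDerivAt (fun r : ℝ => H (((-r * t : ℝ) : ℂ) * Complex.I)) 0 0 := by
          have h3 : HasDerivAt (fun r : ℝ => -r * t) (-1 * t) 0 :=
            (hasDerivAt_neg (0 : ℝ)).mul_const t
          have h4 : HasDerivAt (fun t : ℝ => H (t * Complex.I)) 0 (-0 * t) := by simpa using ho
          have := h4.scomp (0 : ℝ) h3
          simpa [Function.comp_def] using this
        have h5 := h2.tendsto_slope.mono_left (nhdsWithin_mono 0 fun r (hr : r < 0) => hr.ne)
        have h6 := h5.neg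
        rw [neg_zero] at h6
        refine h6.congr fun r => ?_
        simp only [slope, vsub_eq_sub, sub_zero, neg_zero, zero_mul, Complex.ofReal_zero, h0]
        rw [Complex.real_smul, Complex.ofReal_inv, Complex.ofReal_neg, div_eq_inv_mul, inv_neg]
        simp only [neg_mul]
      have h7 := (h1.mul_const ((w + 1) ^ 2)).norm
      rw [zero_mul, norm_zero] at h7
      refine h7.congr fun r => ?_
      rw [rescaled, ht]
      congr 1
      push_cast
      rw [← mul_assoc]
      ring
  rw [intervalIntegral.integral_zero] at hint
  have hbound : ∀ r : ℝ, r < 0 → ‖h r‖ ≤ 2 * ∫ θ in (0 : ℝ)..2 * Real.pi,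
      ‖rescaled H (-r) (circleMap 0 1 θ)‖ := by
    intro r hr
    have hy : 0 < -r := neg_pos.2 hr
    have hdc : DiffContOnCl ℂ (rescaled H (-r)) (Metric.ball 0 1) :=
      ⟨fun w hw => (hasDerivAt_rescaled hd hy
        (by simpa using hw)).differentiableAt.differentiableWithinAt,
        (continuous_rescaled hH h0 hy).continuousOn⟩
    obtain ⟨h1, h2⟩ := norm_value_deriv_le_integral_norm hdc
    have h3 := (hasDerivAt_rescaled hd hy (w := 0) (by simp)).deriv
    -- The product rule at the centre: the factor `(w + 1) ^ 2` contributes the term `2 * rescaled H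
    -- (-r) 0`.
    have h4 : (2 : ℂ) * h r = deriv (rescaled H (-r)) 0 - 2 * rescaled H (-r) 0 := by
      have hrc : (r : ℂ) ≠ 0 := by exact_mod_cast hr.ne
      rw [h3, rescaled]
      simp only [discToPlane]
      push_cast
      norm_num
      field_simp
      ring
    have h5 : 2 * ‖h r‖ ≤ ‖deriv (rescaled H (-r)) 0‖ + 2 * ‖rescaled H (-r) 0‖ := by
      calc 2 * ‖h r‖ = ‖(2 : ℂ) * h r‖ := by simp
        _ ≤ _ := by
          rw [h4]
          refine (norm_sub_le _ _).trans_eq ?_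
          simp
    have h6 := norm_nonneg (rescaled H (-r) 0)
    linarith
  refine squeeze_zero_norm' ?_ (by simpa using hint.const_mul 2)
  filter_upwards [self_mem_nhdsWithin] with r hr
  exact hbound r hr

/-- **Fatou's theorem**: a bounded analytic function on the left half-plane has horizontal limits
at almost every point of the imaginary axis. -/
theorem ae_exists_tendsto_boundary {g : ℂ → ℂ} (hg : DifferentiableOn ℂ g {s | s.re < 0}) {M : ℝ}
    (hM : ∀ s : ℂ, s.re < 0 → ‖g s‖ ≤ M) :
    ∀ᵐ ω : ℝ, ∃ c, Tendsto (fun r : ℝ => g (r + ω * Complex.I)) (𝓝[<] 0) (𝓝 c) := by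
  obtain ⟨K, G, hG, hGd⟩ := exists_lipschitz_primitive hg hM
  have hlip : LipschitzWith (K * 1) fun ω : ℝ => G (ω * Complex.I) := by
    refine hG.comp (LipschitzWith.of_dist_le_mul fun a b => ?_)
    rw [dist_eq_norm, ← sub_mul, norm_mul, Complex.norm_I, mul_one, ← Complex.ofReal_sub,
      Complex.norm_real, NNReal.coe_one, one_mul, dist_eq_norm]
  filter_upwards [hlip.ae_differentiableAt_real] with ω hω
  set d := deriv (fun ω : ℝ => G (ω * Complex.I)) ω
  have hd' : HasDerivAt (fun ω : ℝ => G (ω * Complex.I)) d ω := hω.hasDerivAt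
  -- The derivative along the axis is `i` times the expected complex derivative `c`. Subtracting `c
  -- * s` from the primitive reduces the claim to tangential derivative zero.
  set c := -Complex.I * d
  have hcI : c * Complex.I = d := by
    simp only [c]
    linear_combination (-d) * Complex.I_mul_I
  refine ⟨c, ?_⟩
  have hshift : LipschitzWith K fun s : ℂ => G (s + ω * Complex.I) := by
    refine LipschitzWith.of_dist_le_mul fun a b => ?_
    simpa using hG.dist_le_mul (a + ω * Complex.I) (b + ω * Complex.I)
  have hlin : LipschitzWith ‖c‖₊ fun s : ℂ => c * s := by
    refine LipschitzWith.of_dist_le_mul fun a b => ?_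
    rw [dist_eq_norm, ← mul_sub, norm_mul, dist_eq_norm, coe_nnnorm]
  have hconst : LipschitzWith 0 fun _ : ℂ => G (ω * Complex.I) := LipschitzWith.const _
  have := tendsto_deriv_of_hasDerivAt_zero
    (H := fun s => G (s + ω * Complex.I) - G (ω * Complex.I) - c * s)
    (h := fun s => g (s + ω * Complex.I) - c) ((hshift.sub hconst).sub hlin) (by simp) ?_ ?_
  · simpa using this.add_const c
  · intro s hs
    have h1 : HasDerivAt (fun s => G (s + ω * Complex.I)) (g (s + ω * Complex.I)) s :=
      (hGd _ (by simpa using hs)).comp_add_const s _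
    have h2 : HasDerivAt (fun s => c * s) c s := by simpa using (hasDerivAt_id s).const_mul c
    exact (h1.sub_const _).sub h2
  · have h1 : HasDerivAt (fun t : ℝ => G (((t + ω : ℝ) : ℂ) * Complex.I)) d 0 := by
      have := HasDerivAt.comp_add_const (f := fun ω : ℝ => G (ω * Complex.I)) (0 : ℝ) ω
        (by simpa using hd')
      exact this
    have h2 : HasDerivAt (fun t : ℝ => c * ((t : ℂ) * Complex.I)) d 0 := by
      have h3 := ((Complex.ofRealCLM.hasDerivAt (x := (0 : ℝ))).mul_const Complex.I).const_mul c
      simpa [hcI] using h3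
    have h4 := (h1.sub_const (G (ω * Complex.I))).sub h2
    rw [sub_self] at h4
    refine h4.congr_of_eventuallyEq (.of_forall fun t => ?_)
    simp only [Pi.sub_apply]
    push_cast
    ring_nf

/-! ### The symbol of a function in `H∞⁻` -/

theorem HInftyMinus.ae_exists_tendsto (g : HInftyMinus) :
    ∀ᵐ ξ : ℝ, ∃ c, Tendsto (fun r : ℝ => (g : ℂ → ℂ) (r + ((2 * Real.pi * ξ : ℝ) : ℂ) * Complex.I))
      (𝓝[<] 0) (𝓝 c) := by
  obtain ⟨g, hg, M, hM⟩ := g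
  have h := ae_exists_tendsto_boundary hg hM
  have hq : Measure.QuasiMeasurePreserving (fun ξ : ℝ => 2 * Real.pi * ξ) volume volume := by
    refine ⟨by fun_prop, ?_⟩
    rw [Real.map_volume_mul_left (by positivity)]
    exact Measure.smul_absolutelyContinuous
  exact hq.ae h

theorem HInftyMinus.ae_tendsto (g : HInftyMinus) :
    ∀ᵐ ξ : ℝ, Tendsto (fun r : ℝ => (g : ℂ → ℂ) (r + ((2 * Real.pi * ξ : ℝ) : ℂ) * Complex.I))
      (𝓝[<] 0) (𝓝 (boundaryFun g (2 * Real.pi * ξ))) := by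
  filter_upwards [HInftyMinus.ae_exists_tendsto g] with ξ hξ
  exact tendsto_nhds_limUnder hξ

theorem HInftyMinus.norm_le_hInftyNorm (g : HInftyMinus) {s : ℂ} (hs : s.re < 0) :
    ‖(g : ℂ → ℂ) s‖ ≤ hInftyNorm g := by
  obtain ⟨M, hM⟩ := g.2.2
  exact le_ciSup (f := fun s : {s : ℂ // s.re < 0} => ‖(g : ℂ → ℂ) s‖)
    ⟨M, by rintro _ ⟨s, rfl⟩; exact hM s s.2⟩ ⟨s, hs⟩

theorem HInftyMinus.ae_norm_boundaryFun_le (g : HInftyMinus) :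
    ∀ᵐ ξ : ℝ, ‖boundaryFun g (2 * Real.pi * ξ)‖ ≤ hInftyNorm g := by
  filter_upwards [HInftyMinus.ae_tendsto g] with ξ hξ
  refine le_of_tendsto hξ.norm ?_
  filter_upwards [self_mem_nhdsWithin] with r hr
  exact HInftyMinus.norm_le_hInftyNorm g (by simpa using hr)

theorem tendsto_neg_one_div_nhdsLT :
    Tendsto (fun n : ℕ => -(1 / ((n : ℝ) + 1))) atTop (𝓝[<] 0) := by
  refine tendsto_nhdsWithin_iff.2 ⟨?_, .of_forall fun n => ?_⟩
  · simpa using (tendsto_one_div_add_atTop_nhds_zero_nat (𝕜 := ℝ)).neg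
  · exact mem_Iio.2 (neg_neg_of_pos (by positivity))

theorem HInftyMinus.continuous_comp_shift (g : HInftyMinus) {r : ℝ} (hr : r < 0) :
    Continuous fun ξ : ℝ => (g : ℂ → ℂ) (r + ((2 * Real.pi * ξ : ℝ) : ℂ) * Complex.I) :=
  g.2.1.continuousOn.comp_continuous (by fun_prop) fun ξ => by simpa using hr

/-- The boundary function of `g`, as a bounded symbol. -/
noncomputable def bdrySymbol (g : HInftyMinus) : essBdd :=
  ⟨fun ξ => boundaryFun g (2 * Real.pi * ξ), by
    refine ⟨?_, _, HInftyMinus.ae_norm_boundaryFun_le g⟩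
    -- Measurability comes from the almost everywhere limit of the continuous functions on vertical
    -- lines approaching the axis.
    refine aestronglyMeasurable_of_tendsto_ae (u := atTop)
      (f := fun (n : ℕ) (ξ : ℝ) => (g : ℂ → ℂ)
        ((-(1 / ((n : ℝ) + 1)) : ℝ) + ((2 * Real.pi * ξ : ℝ) : ℂ) * Complex.I)) ?_ ?_
    · exact fun n => (HInftyMinus.continuous_comp_shift g
        (neg_neg_of_pos (by positivity))).aestronglyMeasurable
    · filter_upwards [HInftyMinus.ae_tendsto g] with ξ hξ
      exact hξ.comp tendsto_neg_one_div_nhdsLT⟩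

theorem HInftyMinus.tendsto_symbol (g : HInftyMinus) :
    ∀ᵐ ξ : ℝ, Tendsto (fun r : ℝ => (g : ℂ → ℂ) (r + ((2 * Real.pi * ξ : ℝ) : ℂ) * Complex.I))
      (𝓝[<] 0) (𝓝 ((bdrySymbol g : ℝ → ℂ) ξ)) := HInftyMinus.ae_tendsto g

theorem HInftyMinus.norm_symbol_le (g : HInftyMinus) :
    ∀ᵐ ξ : ℝ, ‖(bdrySymbol g : ℝ → ℂ) ξ‖ ≤ hInftyNorm g := HInftyMinus.ae_norm_boundaryFun_le g

/-! ### Approximation of symbols by exponentials -/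

/-- A subset of the symbols closed under bounded almost everywhere convergence of sequences. -/
def IsBddClosed (S : Set essBdd) : Prop :=
  ∀ (b : ℕ → essBdd) (b₀ : essBdd), BddTendsto atTop b b₀ → (∀ n, b n ∈ S) → b₀ ∈ S

/-- The boundary variable `s = 2πiξ`. -/
noncomputable def bdryVar (ξ : ℝ) : ℂ := ((2 * Real.pi * ξ : ℝ) : ℂ) * Complex.I

theorem bdryVar_re (ξ : ℝ) : (bdryVar ξ).re = 0 := by simp [bdryVar]

theorem continuous_bdryVar : Continuous bdryVar := by unfold bdryVar; fun_prop

theorem expSymbol_eq_exp (τ ξ : ℝ) : (expSymbol τ : ℝ → ℂ) ξ = Complex.exp (τ * bdryVar ξ) := by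
  rw [expSymbol_apply, bdryVar]
  push_cast
  rfl

theorem norm_planeToDisc_bdryVar_le (ξ : ℝ) : ‖planeToDisc (bdryVar ξ)‖ ≤ 1 :=
  norm_planeToDisc_le_one (bdryVar_re ξ).le

theorem continuous_planeToDisc_bdryVar : Continuous fun ξ => planeToDisc (bdryVar ξ) :=
  continuous_iff_continuousAt.2 fun ξ =>
    ((hasDerivAt_planeToDisc (bdryVar_re ξ).le).continuousAt).comp continuous_bdryVar.continuousAt

/-- The symbol of the Cayley transform. -/
noncomputable def cayleySymbol : essBdd :=
  ⟨fun ξ => planeToDisc (bdryVar ξ), continuous_planeToDisc_bdryVar.aestronglyMeasurable, 1,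
    .of_forall norm_planeToDisc_bdryVar_le⟩

/-- The symbol of `s ↦ (1 - s)⁻¹`. -/
noncomputable def resolventSymbol : essBdd :=
  ⟨fun ξ => (1 - bdryVar ξ)⁻¹, by
    refine ⟨(Continuous.inv₀ (by have := continuous_bdryVar; fun_prop) fun ξ =>
      one_sub_ne_zero_of_re_nonpos (bdryVar_re ξ).le).aestronglyMeasurable, 1,
      .of_forall fun ξ => ?_⟩
    rw [norm_inv]
    refine inv_le_one_of_one_le₀ ?_
    have := Complex.abs_re_le_norm (1 - bdryVar ξ)
    simpa [bdryVar_re] using this⟩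

/-- Riemann sums for `∫₀^∞ e^{-t} e^{st} dt`. -/
noncomputable def riemannSymbol (n : ℕ) : essBdd :=
  -- With step `1 / (n + 1)`, the `(n + 1) ^ 2` nodes cover `[0, n + 1)`, so mesh and tail vanish
  -- together.
  ((1 / ((n : ℝ) + 1) : ℝ) : ℂ) • ∑ k ∈ Finset.range ((n + 1) ^ 2),
    ((Real.exp (-(1 / ((n : ℝ) + 1))) : ℂ) • expSymbol (1 / ((n : ℝ) + 1))) ^ k

theorem riemannSymbol_apply (n : ℕ) (ξ : ℝ) :
    (riemannSymbol n : ℝ → ℂ) ξ = ((1 / ((n : ℝ) + 1) : ℝ) : ℂ) *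
      ∑ k ∈ Finset.range ((n + 1) ^ 2),
        Complex.exp (((1 / ((n : ℝ) + 1) : ℝ) : ℂ) * (bdryVar ξ - 1)) ^ k := by
  have h : ∀ k : ℕ, ((((Real.exp (-(1 / ((n : ℝ) + 1))) : ℂ) •
      expSymbol (1 / ((n : ℝ) + 1))) ^ k : essBdd) : ℝ → ℂ) ξ =
      Complex.exp (((1 / ((n : ℝ) + 1) : ℝ) : ℂ) * (bdryVar ξ - 1)) ^ k := by
    intro k
    change ((Real.exp (-(1 / ((n : ℝ) + 1))) : ℂ) *
      (expSymbol (1 / ((n : ℝ) + 1)) : ℝ → ℂ) ξ) ^ k = _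
    rw [expSymbol_eq_exp, Complex.ofReal_exp, ← Complex.exp_add]
    congr 2
    push_cast
    ring
  rw [riemannSymbol]
  change _ * ((∑ k ∈ Finset.range ((n + 1) ^ 2), _ : essBdd) : ℝ → ℂ) ξ = _
  rw [AddSubmonoidClass.coe_finsetSum, Finset.sum_apply]
  simp_rw [h]

theorem norm_exp_mul_bdryVar_sub_one (h ξ : ℝ) :
    ‖Complex.exp ((h : ℂ) * (bdryVar ξ - 1))‖ = Real.exp (-h) := by
  rw [Complex.norm_exp, Complex.re_ofReal_mul, Complex.sub_re, bdryVar_re]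
  simp

theorem norm_riemannSymbol_le (n : ℕ) (ξ : ℝ) : ‖(riemannSymbol n : ℝ → ℂ) ξ‖ ≤ 2 := by
  set h : ℝ := 1 / ((n : ℝ) + 1) with hdef
  have h0 : 0 < h := by positivity
  have h1 : h ≤ 1 := by
    rw [hdef, div_le_one (by positivity)]
    linarith [(n.cast_nonneg : (0 : ℝ) ≤ n)]
  rw [riemannSymbol_apply, norm_mul, ← hdef, Complex.norm_of_nonneg h0.le]
  have hq : Real.exp (-h) < 1 := by simpa using h0
  have hsum : ‖∑ k ∈ Finset.range ((n + 1) ^ 2), Complex.exp ((h : ℂ) * (bdryVar ξ - 1)) ^ k‖ ≤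
      (1 - Real.exp (-h))⁻¹ := by
    refine (norm_sum_le _ _).trans ?_
    simp_rw [norm_pow, norm_exp_mul_bdryVar_sub_one]
    rw [← tsum_geometric_of_lt_one (Real.exp_pos _).le hq]
    exact (summable_geometric_of_lt_one (Real.exp_pos _).le hq).sum_le_tsum _
      fun _ _ => by positivity
  -- This gives `h / (1 - exp (-h)) ≤ 1 + h ≤ 2`.
  have hexp : Real.exp (-h) ≤ (1 + h)⁻¹ := by
    rw [Real.exp_neg]
    exact inv_anti₀ (by positivity) (by linarith [Real.add_one_le_exp h])
  have hbound : h * (1 - Real.exp (-h))⁻¹ ≤ 2 := by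
    rw [← div_eq_mul_inv, div_le_iff₀ (by linarith)]
    have h2 : (1 + h) * (1 + h)⁻¹ = 1 := mul_inv_cancel₀ (by positivity)
    nlinarith
  exact (mul_le_mul_of_nonneg_left hsum h0.le).trans hbound

/-- The geometric sum is `h (q ^ N - 1) / (q - 1)` with `q = exp (h (s - 1))`. Here `|q ^ N| = exp
(-(n + 1))` tends to `0` and `(q - 1) / h` tends to `s - 1`. -/
theorem tendsto_riemannSymbol (ξ : ℝ) :
    Tendsto (fun n => (riemannSymbol n : ℝ → ℂ) ξ) atTop (𝓝 (1 - bdryVar ξ)⁻¹) := by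
  have hne : bdryVar ξ - 1 ≠ 0 := by
    rw [← neg_sub]
    exact neg_ne_zero.2 (one_sub_ne_zero_of_re_nonpos (bdryVar_re ξ).le)
  have hh : Tendsto (fun n : ℕ => 1 / ((n : ℝ) + 1)) atTop (𝓝[≠] 0) :=
    tendsto_nhdsWithin_iff.2 ⟨tendsto_one_div_add_atTop_nhds_zero_nat, .of_forall fun n => by
      have : (0 : ℝ) < 1 / ((n : ℝ) + 1) := by positivity
      exact this.ne'⟩
  have hd : HasDerivAt (fun h : ℝ => Complex.exp ((h : ℂ) * (bdryVar ξ - 1))) (bdryVar ξ - 1) 0 := by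
    have h1 : HasDerivAt (fun h : ℝ => (h : ℂ) * (bdryVar ξ - 1)) (1 * (bdryVar ξ - 1)) 0 :=
      (Complex.ofRealCLM.hasDerivAt (x := (0 : ℝ))).mul_const _
    simpa using h1.cexp
  have hs := hd.tendsto_slope.comp hh
  have hpow : Tendsto (fun n : ℕ =>
      Complex.exp (((1 / ((n : ℝ) + 1) : ℝ) : ℂ) * (bdryVar ξ - 1)) ^ ((n + 1) ^ 2)) atTop (𝓝 0) := by
    refine squeeze_zero_norm (a := fun n : ℕ => Real.exp (-((n : ℝ) + 1))) (fun n => ?_) ?_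
    · rw [norm_pow, norm_exp_mul_bdryVar_sub_one, ← Real.exp_nat_mul]
      refine (congrArg Real.exp ?_).le
      have : (n : ℝ) + 1 ≠ 0 := by positivity
      push_cast
      field_simp
    · refine Real.tendsto_exp_atBot.comp (tendsto_neg_atTop_atBot.comp ?_)
      exact tendsto_atTop_add_const_right _ _ tendsto_natCast_atTop_atTop
  have hlim := (hpow.sub_const 1).mul (hs.inv₀ hne)
  have heq : (0 - 1 : ℂ) * (bdryVar ξ - 1)⁻¹ = (1 - bdryVar ξ)⁻¹ := by
    rw [← neg_sub (bdryVar ξ) 1, inv_neg]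
    ring
  rw [heq] at hlim
  refine hlim.congr fun n => ?_
  rw [riemannSymbol_apply, geom_sum_eq]
  · simp only [Function.comp_apply, slope, vsub_eq_sub, sub_zero, Complex.ofReal_zero, zero_mul,
      Complex.exp_zero, Complex.real_smul, mul_inv, Complex.ofReal_inv, inv_inv]
    ring
  · intro h
    have h1 := norm_exp_mul_bdryVar_sub_one (1 / ((n : ℝ) + 1)) ξ
    rw [h, norm_one, eq_comm, Real.exp_eq_one_iff] at h1
    have : (0 : ℝ) < 1 / ((n : ℝ) + 1) := by positivity
    linarith

section Induction

variable {S : Subalgebra ℂ essBdd}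

theorem resolventSymbol_mem (hexp : ∀ τ : ℝ, 0 ≤ τ → expSymbol τ ∈ S)
    (hlim : IsBddClosed (S : Set essBdd)) : resolventSymbol ∈ S := by
  refine hlim riemannSymbol _ ⟨⟨2, .of_forall fun n => .of_forall (norm_riemannSymbol_le n)⟩,
    .of_forall tendsto_riemannSymbol⟩ fun n => ?_
  exact S.smul_mem (sum_mem fun k _ => pow_mem (S.smul_mem (hexp _ (by positivity)) _) k) _

theorem cayleySymbol_mem (hexp : ∀ τ : ℝ, 0 ≤ τ → expSymbol τ ∈ S)
    (hlim : IsBddClosed (S : Set essBdd)) : cayleySymbol ∈ S := by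
  have h : cayleySymbol = (2 : ℂ) • resolventSymbol - 1 := by
    refine Subtype.ext (funext fun ξ => ?_)
    change planeToDisc (bdryVar ξ) = 2 * (1 - bdryVar ξ)⁻¹ - 1
    rw [← div_eq_mul_inv, ← planeToDisc_add_one (bdryVar_re ξ).le]
    ring
  rw [h]
  exact sub_mem (S.smul_mem (resolventSymbol_mem hexp hlim) _) (one_mem _)

/-- The dilation by `r < 1` keeps the values inside a smaller disc, where the Taylor polynomials of
`k` converge uniformly; evaluated here they are polynomials in the Cayley symbol. -/
theorem mem_of_eq_comp_smul_cayley (hexp : ∀ τ : ℝ, 0 ≤ τ → expSymbol τ ∈ S)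
    (hlim : IsBddClosed (S : Set essBdd)) {k : ℂ → ℂ}
    (hk : DifferentiableOn ℂ k (Metric.ball 0 1)) {M : ℝ} (hM : ∀ w : ℂ, ‖w‖ < 1 → ‖k w‖ ≤ M)
    {r : ℝ} (hr0 : 0 ≤ r) (hr1 : r < 1) {b : essBdd}
    (hb : ∀ ξ, (b : ℝ → ℂ) ξ = k (r * planeToDisc (bdryVar ξ))) : b ∈ S := by
  -- `R < 1` is the radius of the Cauchy power series, and `r'` between `r` and `R` gives uniform
  -- convergence.
  obtain ⟨r', hrr', hr'1⟩ := exists_between hr1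
  obtain ⟨R, hr'R, hR1⟩ := exists_between hr'1
  lift r' to ℝ≥0 using hr0.trans hrr'.le
  lift R to ℝ≥0 using r'.2.trans hr'R.le
  have hR0 : 0 < R := lt_of_le_of_lt (zero_le (a := r')) (by exact_mod_cast hr'R)
  have hps := (hk.mono (Metric.closedBall_subset_ball hR1)).hasFPowerSeriesOnBall hR0
  have hunif := hps.tendstoUniformlyOn (r' := r') (by exact_mod_cast hr'R)
  set p := cauchyPowerSeries k 0 R
  have hmem : ∀ ξ, (r : ℂ) * planeToDisc (bdryVar ξ) ∈ Metric.ball (0 : ℂ) r' := by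
    intro ξ
    rw [mem_ball_zero_iff, norm_mul, Complex.norm_of_nonneg hr0]
    exact (mul_le_of_le_one_right hr0 (norm_planeToDisc_bdryVar_le ξ)).trans_lt hrr'
  let q : ℕ → essBdd := fun n => ∑ i ∈ Finset.range n, p.coeff i • ((r : ℂ) • cayleySymbol) ^ i
  have hq : ∀ n ξ, (q n : ℝ → ℂ) ξ = p.partialSum n (r * planeToDisc (bdryVar ξ)) := by
    intro n ξ
    simp only [q]
    rw [AddSubmonoidClass.coe_finsetSum, Finset.sum_apply, FormalMultilinearSeries.partialSum]
    refine Finset.sum_congr rfl fun i _ => ?_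
    rw [FormalMultilinearSeries.apply_eq_pow_smul_coeff, smul_eq_mul, mul_comm]
    rfl
  refine hlim q b ⟨⟨1 + M, ?_⟩, .of_forall fun ξ => ?_⟩ fun n => ?_
  · filter_upwards [Metric.tendstoUniformlyOn_iff.1 hunif 1 one_pos] with n hn
    refine .of_forall fun ξ => ?_
    have h1 := hn _ (hmem ξ)
    rw [zero_add, dist_comm, dist_eq_norm] at h1
    rw [hq]
    have h2 := hM (r * planeToDisc (bdryVar ξ))
      ((mem_ball_zero_iff.1 (hmem ξ)).trans hr'1)
    calc ‖p.partialSum n (r * planeToDisc (bdryVar ξ))‖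
        ≤ ‖p.partialSum n (r * planeToDisc (bdryVar ξ)) - k (r * planeToDisc (bdryVar ξ))‖ +
          ‖k (r * planeToDisc (bdryVar ξ))‖ := norm_le_norm_sub_add _ _
      _ ≤ 1 + M := add_le_add h1.le h2
  · have := hunif.tendsto_at (hmem ξ)
    rw [zero_add, ← hb] at this
    simpa only [hq] using this
  · exact sum_mem fun i _ => S.smul_mem
      (pow_mem (S.smul_mem (cayleySymbol_mem hexp hlim) _) i) _

/-- The shift by `δ` makes the function analytic across the axis. On the disc it is continuous at
each circle point except `w = -1`, which corresponds to no `ξ`, so radial dilations converge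
pointwise. -/
theorem mem_of_eq_shift (hexp : ∀ τ : ℝ, 0 ≤ τ → expSymbol τ ∈ S)
    (hlim : IsBddClosed (S : Set essBdd)) (g : HInftyMinus) {δ : ℝ} (hδ : 0 < δ) {b : essBdd}
    (hb : ∀ ξ, (b : ℝ → ℂ) ξ = (g : ℂ → ℂ) (bdryVar ξ - δ)) : b ∈ S := by
  obtain ⟨g, hg, M, hM⟩ := g
  have hre : ∀ {s : ℂ}, s.re ≤ 0 → (s - δ).re < 0 := by
    intro s hs
    simp only [Complex.sub_re, Complex.ofReal_re]
    linarith
  have hgat : ∀ {s : ℂ}, s.re ≤ 0 → DifferentiableAt ℂ (fun s => g (s - δ)) s := fun {s} hs =>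
    DifferentiableAt.comp (f := fun s : ℂ => s - δ) s
      (hg.differentiableAt (isOpen_re_neg.mem_nhds (hre hs))) (by fun_prop)
  have hkd : ∀ {w : ℂ}, ‖w‖ ≤ 1 → w + 1 ≠ 0 →
      DifferentiableAt ℂ (fun w => g (discToPlane w - δ)) w := fun {w} hw hw1 =>
    DifferentiableAt.comp (g := fun s => g (s - δ)) w (hgat (discToPlane_re_nonpos hw))
      (hasDerivAt_discToPlane hw1).differentiableAt
  have hk : DifferentiableOn ℂ (fun w => g (discToPlane w - δ)) (Metric.ball 0 1) := by
    intro w hw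
    have hw1 : ‖w‖ < 1 := by simpa using hw
    exact (hkd hw1.le (add_one_ne_zero_of_norm_lt hw1)).differentiableWithinAt
  have hkM : ∀ w : ℂ, ‖w‖ < 1 → ‖g (discToPlane w - δ)‖ ≤ M := fun w hw =>
    hM _ (hre (discToPlane_re_neg hw).le)
  have hr0 : ∀ n : ℕ, (0 : ℝ) ≤ 1 - 1 / ((n : ℝ) + 1) := fun n => by
    rw [sub_nonneg, div_le_one (by positivity)]
    linarith [(n.cast_nonneg : (0 : ℝ) ≤ n)]
  have hr1 : ∀ n : ℕ, 1 - 1 / ((n : ℝ) + 1) < 1 := fun n => by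
    have : (0 : ℝ) < 1 / ((n : ℝ) + 1) := by positivity
    linarith
  have hlt : ∀ (n : ℕ) (ξ : ℝ),
      ‖((1 - 1 / ((n : ℝ) + 1) : ℝ) : ℂ) * planeToDisc (bdryVar ξ)‖ < 1 := fun n ξ => by
    rw [norm_mul, Complex.norm_of_nonneg (hr0 n)]
    exact (mul_le_of_le_one_right (hr0 n) (norm_planeToDisc_bdryVar_le ξ)).trans_lt (hr1 n)
  let q : ℕ → essBdd := fun n =>
    ⟨fun ξ => g (discToPlane (((1 - 1 / ((n : ℝ) + 1) : ℝ) : ℂ) * planeToDisc (bdryVar ξ)) - δ),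
      (hk.continuousOn.comp_continuous (continuous_const.mul continuous_planeToDisc_bdryVar)
        fun ξ => by simpa using hlt n ξ).aestronglyMeasurable,
      M, .of_forall fun ξ => hkM _ (hlt n ξ)⟩
  refine hlim q b ⟨⟨M, .of_forall fun n => .of_forall fun ξ => hkM _ (hlt n ξ)⟩,
    .of_forall fun ξ => ?_⟩ fun n => ?_
  · have hw : planeToDisc (bdryVar ξ) + 1 ≠ 0 := by
      rw [planeToDisc_add_one (bdryVar_re ξ).le]
      exact div_ne_zero two_ne_zero (one_sub_ne_zero_of_re_nonpos (bdryVar_re ξ).le)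
    have h1 := (hkd (norm_planeToDisc_bdryVar_le ξ) hw).continuousAt.tendsto
    rw [discToPlane_planeToDisc (bdryVar_re ξ).le] at h1
    rw [hb]
    refine h1.comp ?_
    have h2 : Tendsto (fun n : ℕ => ((1 - 1 / ((n : ℝ) + 1) : ℝ) : ℂ)) atTop (𝓝 1) := by
      have h3 := (tendsto_one_div_add_atTop_nhds_zero_nat (𝕜 := ℝ)).const_sub 1
      rw [sub_zero] at h3
      exact_mod_cast (Complex.continuous_ofReal.tendsto 1).comp h3
    simpa using h2.mul_const (planeToDisc (bdryVar ξ))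
  · exact mem_of_eq_comp_smul_cayley hexp hlim hk hkM (hr0 n) (hr1 n) fun ξ => rfl

/-- An algebra of symbols that contains the exponentials `exp (τ s)`, `τ ≥ 0`, and is closed under
bounded convergence contains the symbols of all functions in `H∞⁻`. -/
theorem HInftyMinus.symbol_mem (hexp : ∀ τ : ℝ, 0 ≤ τ → expSymbol τ ∈ S)
    (hlim : IsBddClosed (S : Set essBdd)) (g : HInftyMinus) : bdrySymbol g ∈ S := by
  have hneg : ∀ n : ℕ, -(1 / ((n : ℝ) + 1)) < 0 := fun n => neg_neg_of_pos (by positivity)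
  have hbd : ∀ (n : ℕ) (ξ : ℝ), ‖(g : ℂ → ℂ)
      ((-(1 / ((n : ℝ) + 1)) : ℝ) + ((2 * Real.pi * ξ : ℝ) : ℂ) * Complex.I)‖ ≤ hInftyNorm g :=
    fun n ξ => HInftyMinus.norm_le_hInftyNorm g (by
      rw [Complex.add_re, Complex.ofReal_re, Complex.re_ofReal_mul, Complex.I_re, mul_zero, add_zero]
      exact hneg n)
  let q : ℕ → essBdd := fun n =>
    ⟨fun ξ => (g : ℂ → ℂ) ((-(1 / ((n : ℝ) + 1)) : ℝ) + ((2 * Real.pi * ξ : ℝ) : ℂ) * Complex.I),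
      (HInftyMinus.continuous_comp_shift g (hneg n)).aestronglyMeasurable, _, .of_forall (hbd n)⟩
  refine hlim q _ ⟨⟨_, .of_forall fun n => .of_forall (hbd n)⟩, ?_⟩ fun n => ?_
  · filter_upwards [HInftyMinus.tendsto_symbol g] with ξ hξ
    exact hξ.comp tendsto_neg_one_div_nhdsLT
  · refine mem_of_eq_shift hexp hlim g (δ := 1 / ((n : ℝ) + 1)) (by positivity) fun ξ => ?_
    refine congrArg (g : ℂ → ℂ) ?_
    rw [bdryVar]
    push_cast
    ring

end Induction

/-! ### Exponentially stable semigroups -/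

namespace C0Semigroup

section Stable

variable {X : Type*} [NormedAddCommGroup X] [InnerProductSpace ℂ X] (T : C0Semigroup X)

theorem add_apply' (s t : ℝ≥0) (x : X) : T.toFun (s + t) x = T.toFun s (T.toFun t x) := by
  rw [T.map_add]
  rfl

theorem zero_apply' (x : X) : T.toFun 0 x = x := by
  rw [T.map_zero]
  rfl

variable {T}

theorem ExponentiallyStable.exists_bound (hT : T.ExponentiallyStable) :
    ∃ M : ℝ, 0 ≤ M ∧ ∀ t, ‖T.toFun t‖ ≤ M := by
  obtain ⟨M, ω, hω, h⟩ := hT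
  have hM : 0 ≤ M := by simpa using (norm_nonneg _).trans (h 0)
  refine ⟨M, hM, fun t => (h t).trans (mul_le_of_le_one_right hM ?_)⟩
  rw [Real.exp_le_one_iff, neg_nonpos]
  positivity

theorem tendsto_nhds_zero (x : X) : Tendsto (fun t : ℝ≥0 => T.toFun t x) (𝓝 0) (𝓝 x) := by
  have h : ContinuousWithinAt (fun t : ℝ≥0 => T.toFun t x) (Ioi 0) 0 := by
    rw [ContinuousWithinAt, T.zero_apply']
    exact T.tendsto_zero x
  have h2 := (continuousWithinAt_Ioi_iff_Ici.1 h)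
  rw [show Ici (0 : ℝ≥0) = univ from by ext; simp, continuousWithinAt_univ, ContinuousAt,
    T.zero_apply'] at h2
  exact h2

/-- A uniform bound `M` on the semigroup reduces continuity at `s` to continuity at `0`, from both
sides. -/
theorem ExponentiallyStable.continuous_orbit (hT : T.ExponentiallyStable) (x : X) :
    Continuous fun t : ℝ≥0 => T.toFun t x := by
  obtain ⟨M, hM, hb⟩ := hT.exists_bound
  have hle : ∀ s t : ℝ≥0, s ≤ t →
      ‖T.toFun t x - T.toFun s x‖ ≤ M * ‖T.toFun (nndist t s) x - x‖ := by
    intro s t hst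
    have h : t = s + nndist t s := by
      refine NNReal.eq ?_
      rw [NNReal.coe_add, coe_nndist, NNReal.dist_eq, abs_of_nonneg (by simpa using hst)]
      ring
    calc ‖T.toFun t x - T.toFun s x‖ = ‖T.toFun s (T.toFun (nndist t s) x - x)‖ := by
          rw [map_sub, ← T.add_apply', ← h]
      _ ≤ M * ‖T.toFun (nndist t s) x - x‖ := (T.toFun s).le_of_opNorm_le (hb s) _
  have hle' : ∀ s t : ℝ≥0,
      ‖T.toFun t x - T.toFun s x‖ ≤ M * ‖T.toFun (nndist t s) x - x‖ := by
    intro s t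
    rcases le_total s t with h | h
    · exact hle s t h
    · rw [norm_sub_rev, nndist_comm]
      exact hle t s h
  rw [continuous_iff_continuousAt]
  intro s
  rw [ContinuousAt, tendsto_iff_norm_sub_tendsto_zero]
  refine squeeze_zero (fun _ => norm_nonneg _) (hle' s) ?_
  have h1 : Tendsto (fun t : ℝ≥0 => nndist t s) (𝓝 s) (𝓝 0) := by
    have : Continuous fun t : ℝ≥0 => nndist t s := by fun_prop
    simpa using this.tendsto s
  have h2 := ((tendsto_nhds_zero (T := T) x).comp h1).sub_const x
  simpa using h2.norm.const_mul M

theorem ExponentiallyStable.continuous_orbit_toNNReal (hT : T.ExponentiallyStable) (x : X) :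
    Continuous fun t : ℝ => T.toFun t.toNNReal x :=
  (hT.continuous_orbit x).comp continuous_real_toNNReal

variable (T) in
theorem toNNReal_add_coe {t : ℝ} (ht : 0 ≤ t) (τ : ℝ≥0) (x : X) :
    T.toFun (t + τ).toNNReal x = T.toFun t.toNNReal (T.toFun τ x) := by
  rw [Real.toNNReal_add ht τ.coe_nonneg, T.add_apply', Real.toNNReal_coe]

variable (T) in
theorem comm_apply (s t : ℝ≥0) (x : X) : T.toFun s (T.toFun t x) = T.toFun t (T.toFun s x) := by
  rw [← T.add_apply', add_comm, T.add_apply']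

theorem tendsto_coe_nhdsGT_zero :
    Tendsto (fun h : ℝ≥0 => (h : ℝ)) (𝓝[>] 0) (𝓝[>] 0) :=
  tendsto_nhdsWithin_iff.2 ⟨(NNReal.continuous_coe.tendsto' 0 0 rfl).mono_left nhdsWithin_le_nhds,
    by filter_upwards [self_mem_nhdsWithin] with h hh using NNReal.coe_pos.2 hh⟩

/-- The averages `ε⁻¹ ∫₀^ε T(t) x dt` tend to `x`. They lie in `D(A)`, because applying `T(h)`
merely shifts the interval of integration. -/
theorem ExponentiallyStable.dense_domain [CompleteSpace X] (hT : T.ExponentiallyStable) :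
    Dense (T.generator.domain : Set X) := by
  intro x
  set u : ℝ → X := fun t => T.toFun t.toNNReal x with hu
  have hcont : Continuous u := hT.continuous_orbit_toNNReal x
  have hint : ∀ a b, IntervalIntegrable u volume a b := fun a b => hcont.intervalIntegrable a b
  have hder : ∀ a, HasDerivAt (fun b => ∫ t in (0 : ℝ)..b, u t) (u a) a := fun a =>
    intervalIntegral.integral_hasDerivAt_right (hint 0 a)
      (hcont.stronglyMeasurableAtFilter _ _) hcont.continuousAt
  have hu0 : u 0 = x := by simp [hu, T.zero_apply']
  have hmem : ∀ ε : ℝ, 0 < ε → (∫ t in (0 : ℝ)..ε, u t) ∈ T.generator.domain := by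
    intro ε hε
    refine ⟨u ε - u 0, ?_⟩
    have hd : HasDerivAt (fun h : ℝ => (∫ t in (0 : ℝ)..ε + h, u t) - ∫ t in (0 : ℝ)..h, u t)
        (u ε - u 0) 0 := by
      have h1 : HasDerivAt (fun h : ℝ => ∫ t in (0 : ℝ)..ε + h, u t) (u ε) 0 :=
        HasDerivAt.comp_const_add (f := fun b => ∫ t in (0 : ℝ)..b, u t) ε 0
          (by simpa using hder ε)
      exact h1.sub (hder 0)
    have hs := (hd.tendsto_slope.mono_left (nhdsGT_le_nhdsNE 0)).comp tendsto_coe_nhdsGT_zero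
    refine hs.congr fun h => ?_
    have hT' : T.toFun h (∫ t in (0 : ℝ)..ε, u t) =
        (∫ t in (0 : ℝ)..ε + h, u t) - ∫ t in (0 : ℝ)..h, u t := by
      rw [← ContinuousLinearMap.intervalIntegral_comp_comm _ (hint 0 ε),
        intervalIntegral.integral_interval_sub_left (hint _ _) (hint _ _)]
      have h2 : ∀ t ∈ uIcc (0 : ℝ) ε, T.toFun h (u t) = u (t + h) := by
        intro t ht
        rw [uIcc_of_le hε.le] at ht
        simp only [hu]
        rw [T.toNNReal_add_coe ht.1, T.comm_apply]
      rw [intervalIntegral.integral_congr h2, intervalIntegral.integral_comp_add_right, zero_add]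
    rw [Function.comp_apply, slope, diffQuot, hT', sub_zero, vsub_eq_sub, add_zero,
      intervalIntegral.integral_same, sub_zero, ← Complex.ofReal_inv, Complex.coe_smul]
  have h0 := (hder 0).tendsto_slope.mono_left (nhdsGT_le_nhdsNE 0)
  rw [hu0] at h0
  refine mem_closure_of_tendsto h0 ?_
  filter_upwards [self_mem_nhdsWithin] with ε hε
  rw [slope, sub_zero, vsub_eq_sub, intervalIntegral.integral_same, sub_zero, ← Complex.coe_smul]
  exact T.generator.domain.smul_mem _ (hmem ε hε)

/-! ### The orbit map -/

theorem ExponentiallyStable.exists_memLp_bound (hT : T.ExponentiallyStable) :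
    ∃ e : ℝ → ℝ, MemLp e 2 halfLine ∧
      ∀ (t : ℝ) (x : X), 0 < t → ‖T.toFun t.toNNReal x‖ ≤ ‖x‖ * ‖e t‖ := by
  obtain ⟨M, ω, hω, h⟩ := hT
  have hM : 0 ≤ M := by simpa using (norm_nonneg _).trans (h 0)
  refine ⟨fun t => M * Real.exp (-(ω * t)), ?_, fun t x ht => ?_⟩
  · rw [memLp_two_iff_integrable_sq_norm (by fun_prop)]
    have h1 : IntegrableOn (fun t => M ^ 2 * Real.exp (-(2 * ω) * t)) (Ioi 0) :=
      (integrableOn_exp_mul_Ioi (by linarith) 0).const_mul _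
    refine h1.congr (.of_forall fun t => ?_)
    simp only [Real.norm_eq_abs, sq_abs]
    rw [mul_pow, ← Real.exp_nat_mul]
    congr 2
    push_cast
    ring
  · rw [Real.norm_of_nonneg (by positivity), mul_comm]
    refine (T.toFun t.toNNReal).le_of_opNorm_le ?_ x
    simpa [Real.coe_toNNReal t ht.le] using h t.toNNReal

theorem ExponentiallyStable.memLp_orbit (hT : T.ExponentiallyStable) (x : X) :
    MemLp (fun t : ℝ => T.toFun t.toNNReal x) 2 halfLine := by
  obtain ⟨e, he, hb⟩ := hT.exists_memLp_bound
  refine he.of_le_mul (c := ‖x‖) (hT.continuous_orbit_toNNReal x).aestronglyMeasurable ?_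
  filter_upwards [ae_restrict_mem measurableSet_Ioi] with t ht
  exact hb t x ht

theorem ExponentiallyStable.coeFn_orbit (hT : T.ExponentiallyStable) (x : X) :
    T.orbit x =ᵐ[halfLine] fun t : ℝ => T.toFun t.toNNReal x :=
  coeFn_toL2 (hT.memLp_orbit x)

/-- The orbit map `x ↦ T(·) x` as a bounded operator. -/
noncomputable def ExponentiallyStable.orbitMap (hT : T.ExponentiallyStable) : X →L[ℂ] L2Half X :=
  LinearMap.mkContinuousOfExistsBound
    { toFun := T.orbit
      map_add' x y := by
        refine Lp.ext ?_
        filter_upwards [hT.coeFn_orbit (x + y), hT.coeFn_orbit x, hT.coeFn_orbit y,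
          Lp.coeFn_add (T.orbit x) (T.orbit y)] with t h1 h2 h3 h4
        rw [h1, h4, Pi.add_apply, h2, h3, _root_.map_add]
      map_smul' c x := by
        refine Lp.ext ?_
        filter_upwards [hT.coeFn_orbit (c • x), hT.coeFn_orbit x,
          Lp.coeFn_smul c (T.orbit x)] with t h1 h2 h3
        rw [RingHom.id_apply, h1, h3, Pi.smul_apply, h2, map_smul] }
    (by
      obtain ⟨e, he, hb⟩ := hT.exists_memLp_bound
      refine ⟨‖he.toLp e‖, fun x => ?_⟩
      rw [mul_comm]
      refine Lp.norm_le_mul_norm_of_ae_le_mul ?_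
      filter_upwards [hT.coeFn_orbit x, he.coeFn_toLp, ae_restrict_mem measurableSet_Ioi]
        with t h1 h2 ht
      rw [h2]
      exact (congrArg norm h1).le.trans (hb t x ht))

theorem ExponentiallyStable.coeFn_orbitMap (hT : T.ExponentiallyStable) (x : X) :
    hT.orbitMap x =ᵐ[halfLine] fun t : ℝ => T.toFun t.toNNReal x := hT.coeFn_orbit x

theorem ae_halfLine_add {p : ℝ → Prop} (h : ∀ᵐ t ∂halfLine, p t) {τ : ℝ} (hτ : 0 ≤ τ) :
    ∀ᵐ t ∂halfLine, p (t + τ) := by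
  rw [ae_restrict_iff' measurableSet_Ioi] at h ⊢
  filter_upwards [(measurePreserving_add_right (volume : Measure ℝ) τ).quasiMeasurePreserving.ae h]
    with t ht h0
  exact ht (add_pos_of_pos_of_nonneg h0 hτ)

/-! ### The orbit map and the output map intertwine the semigroup with left shifts -/

variable [CompleteSpace X]

theorem ExponentiallyStable.orbitMap_semigroup (hT : T.ExponentiallyStable) (τ : ℝ≥0) (x : X) :
    hT.orbitMap (T.toFun τ x) = toep X (expSymbol τ) (hT.orbitMap x) := by
  refine Lp.ext ?_
  filter_upwards [hT.coeFn_orbitMap (T.toFun τ x), coeFn_toep_expSymbol τ.2 (hT.orbitMap x),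
    ae_halfLine_add (hT.coeFn_orbitMap x) τ.2, ae_restrict_mem measurableSet_Ioi]
    with t h1 h2 h3 ht
  have ht' : (0 : ℝ) ≤ t := le_of_lt ht
  refine h1.trans (Eq.trans ?_ (h2.trans h3).symm)
  change T.toFun t.toNNReal (T.toFun τ x) = T.toFun (t + (τ : ℝ)).toNNReal x
  rw [T.toNNReal_add_coe ht']

variable {Y : Type*} [NormedAddCommGroup Y] [InnerProductSpace ℂ Y]

theorem IsOutputMap.norm_sq_le {C : T.generator.domain →ₗ[ℂ] Y} {O : X →L[ℂ] L2Half Y}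
    (hO : T.IsOutputMap C O) (hT : T.ExponentiallyStable) {m : ℝ} (hadm : T.AdmissibleWith C m)
    (x : X) : ‖O x‖ ^ 2 ≤ m * ‖x‖ ^ 2 := by
  have hclosed : IsClosed {x | ‖O x‖ ^ 2 ≤ m * ‖x‖ ^ 2} :=
    isClosed_le (by fun_prop) (by fun_prop)
  refine closure_minimal (fun x₀ hx₀ => ?_) hclosed (hT.dense_domain x)
  refine le_trans (le_of_eq ?_) (hadm ⟨x₀, hx₀⟩).2
  rw [Lp_norm_sq_eq_integral]
  refine integral_congr_ae ?_
  filter_upwards [hO ⟨x₀, hx₀⟩] with t ht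
  rw [ht]

variable [CompleteSpace Y]

theorem IsOutputMap.map_semigroup {C : T.generator.domain →ₗ[ℂ] Y} {O : X →L[ℂ] L2Half Y}
    (hO : T.IsOutputMap C O) (hT : T.ExponentiallyStable) (τ : ℝ≥0) (x : X) :
    O (T.toFun τ x) = toep Y (expSymbol τ) (O x) := by
  have hclosed : IsClosed {x | O (T.toFun τ x) = toep Y (expSymbol τ) (O x)} :=
    isClosed_eq (O.continuous.comp (T.toFun τ).continuous)
      ((toep Y (expSymbol τ)).continuous.comp O.continuous)
  refine closure_minimal (fun x₀ hx₀ => ?_) hclosed (hT.dense_domain x)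
  refine Lp.ext ?_
  filter_upwards [hO (T.onDomain τ ⟨x₀, hx₀⟩), coeFn_toep_expSymbol τ.2 (O x₀),
    ae_halfLine_add (hO ⟨x₀, hx₀⟩) τ.2, ae_restrict_mem measurableSet_Ioi] with t h1 h2 h3 ht
  have ht' : (0 : ℝ) ≤ t := le_of_lt ht
  refine h1.trans (Eq.trans ?_ (h2.trans h3).symm)
  refine congrArg C (Subtype.ext ?_)
  change T.toFun t.toNNReal (T.toFun τ x₀) = T.toFun (t + (τ : ℝ)).toNNReal x₀
  rw [T.toNNReal_add_coe ht']

end Stable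

end C0Semigroup

/-! ### The functional calculus -/

theorem mulFun_congr {X : Type*} [NormedAddCommGroup X] [InnerProductSpace ℂ X] {a b : essBdd}
    (h : (a : ℝ → ℂ) =ᵐ[volume] b) (F : L2Line X) : mulFun a F = mulFun b F :=
  toL2_congr (by
    filter_upwards [h] with ξ hξ
    rw [hξ])

theorem toep_congr {X : Type*} [NormedAddCommGroup X] [InnerProductSpace ℂ X] [CompleteSpace X]
    {a b : essBdd} (h : (a : ℝ → ℂ) =ᵐ[volume] b) (f : L2Half X) : toep X a f = toep X b f :=
  congrArg (laplaceAdj X) (mulFun_congr h (laplace X f))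

section Calculus

variable {X Y Z : Type*} [NormedAddCommGroup X] [InnerProductSpace ℂ X]
  [NormedAddCommGroup Y] [InnerProductSpace ℂ Y] [CompleteSpace Y]
  [NormedAddCommGroup Z] [InnerProductSpace ℂ Z] [CompleteSpace Z]

/-- The anti-Hardy symbols whose Toeplitz operators on `L²((0, ∞); Y)` and `L²((0, ∞); Z)` are
simultaneously lifted through `O` and `Ψ` to maps of `X`. -/
def calculusAlgebra (O : X →L[ℂ] L2Half Y) (Ψ : X →L[ℂ] L2Half Z) : Subalgebra ℂ essBdd where
  carrier := {b | b ∈ antiHardy Y ∧ b ∈ antiHardy Z ∧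
    ∀ x, ∃ y, O y = toep Y b (O x) ∧ Ψ y = toep Z b (Ψ x)}
  mul_mem' := by
    rintro a b ⟨ha, ha', ha''⟩ ⟨hb, hb', hb''⟩
    refine ⟨mul_mem ha hb, mul_mem ha' hb', fun x => ?_⟩
    obtain ⟨y, hy, hy'⟩ := hb'' x
    obtain ⟨z, hz, hz'⟩ := ha'' y
    exact ⟨z, by rw [hz, hy, toep_mul ha], by rw [hz', hy', toep_mul ha']⟩
  add_mem' := by
    rintro a b ⟨ha, ha', ha''⟩ ⟨hb, hb', hb''⟩
    refine ⟨add_mem ha hb, add_mem ha' hb', fun x => ?_⟩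
    obtain ⟨y, hy, hy'⟩ := hb'' x
    obtain ⟨z, hz, hz'⟩ := ha'' x
    exact ⟨z + y, by rw [map_add, hz, hy, toep_add], by rw [map_add, hz', hy', toep_add]⟩
  algebraMap_mem' := by
    intro c
    refine ⟨Subalgebra.algebraMap_mem _ c, Subalgebra.algebraMap_mem _ c, fun x => ⟨c • x, ?_, ?_⟩⟩
    · rw [Algebra.algebraMap_eq_smul_one, toep_smul, toep_one, map_smul]
    · rw [Algebra.algebraMap_eq_smul_one, toep_smul, toep_one, map_smul]

variable {O : X →L[ℂ] L2Half Y} {Ψ : X →L[ℂ] L2Half Z} {K : ℝ≥0}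

/-- The range of `O` is closed and `O` is a homeomorphism onto it, so the lifts `y n` converge in
`X`; continuity of `Ψ` then passes the second relation to the limit. -/
theorem isBddClosed_calculusAlgebra [CompleteSpace X] (hO : AntilipschitzWith K O) :
    IsBddClosed (calculusAlgebra O Ψ : Set essBdd) := by
  intro b b₀ h hb
  refine ⟨h.mem_antiHardy fun n => (hb n).1, h.mem_antiHardy fun n => (hb n).2.1, fun x => ?_⟩
  choose y hy hy' using fun n => (hb n).2.2 x
  have hemb := hO.isClosedEmbedding O.uniformContinuous
  have hlim : Tendsto (fun n => O (y n)) atTop (𝓝 (toep Y b₀ (O x))) :=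
    (h.toep (O x)).congr fun n => (hy n).symm
  obtain ⟨z, hz⟩ : toep Y b₀ (O x) ∈ range O :=
    hemb.isClosed_range.mem_of_tendsto hlim (.of_forall fun n => mem_range_self _)
  rw [← hz] at hlim
  have hyz : Tendsto y atTop (𝓝 z) := (hemb.tendsto_nhds_iff).2 hlim
  refine ⟨z, hz, tendsto_nhds_unique ((Ψ.continuous.tendsto z).comp hyz) ?_⟩
  exact (h.toep (Ψ x)).congr fun n => (hy' n).symm

/-- The lift of the Toeplitz operator with symbol `b` to `X`. -/
noncomputable def liftSymbol (b : calculusAlgebra O Ψ) (x : X) : X := (b.2.2.2 x).choose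

theorem map_liftSymbol (b : calculusAlgebra O Ψ) (x : X) :
    O (liftSymbol b x) = toep Y b (O x) := (b.2.2.2 x).choose_spec.1

theorem map_liftSymbol' (b : calculusAlgebra O Ψ) (x : X) :
    Ψ (liftSymbol b x) = toep Z b (Ψ x) := (b.2.2.2 x).choose_spec.2

omit [CompleteSpace Y] in
theorem norm_le_of_antilipschitz (hO : AntilipschitzWith K O) (x : X) : ‖x‖ ≤ K * ‖O x‖ := by
  simpa using hO.le_mul_dist x 0

/-- The representation of the algebra of liftable symbols on `X`. -/
noncomputable def calculusHom (hO : AntilipschitzWith K O) :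
    calculusAlgebra O Ψ →ₐ[ℂ] (X →L[ℂ] X) where
  toFun b := LinearMap.mkContinuousOfExistsBound
    { toFun := liftSymbol b
      map_add' x y := hO.injective (by simp only [map_liftSymbol, map_add])
      map_smul' c x := hO.injective (by simp only [map_liftSymbol, map_smul, RingHom.id_apply]) }
    ⟨K * (‖toep Y (b : essBdd)‖ * ‖O‖), fun x => by
      refine (norm_le_of_antilipschitz hO _).trans ?_
      rw [mul_assoc]
      refine mul_le_mul_of_nonneg_left ?_ K.2
      refine (congrArg norm (map_liftSymbol b x)).le.trans ?_
      rw [mul_assoc]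
      exact (ContinuousLinearMap.le_opNorm _ _).trans
        (mul_le_mul_of_nonneg_left (O.le_opNorm x) (norm_nonneg _))⟩
  map_one' := by
    ext1 x
    refine hO.injective ((map_liftSymbol 1 x).trans ?_)
    exact toep_one _
  map_zero' := by
    ext1 x
    refine hO.injective ((map_liftSymbol 0 x).trans ?_)
    change toep Y 0 (O x) = O 0
    rw [← zero_smul ℂ (1 : essBdd), toep_smul, zero_smul, map_zero]
  map_mul' a b := by
    ext1 x
    refine hO.injective ((map_liftSymbol (a * b) x).trans ?_)
    refine Eq.trans ?_ (map_liftSymbol a (liftSymbol b x)).symm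
    rw [map_liftSymbol]
    exact toep_mul a.2.1 _ _
  map_add' a b := by
    ext1 x
    refine hO.injective ((map_liftSymbol (a + b) x).trans ?_)
    refine Eq.trans ?_ (O.map_add (liftSymbol a x) (liftSymbol b x)).symm
    rw [map_liftSymbol, map_liftSymbol]
    exact toep_add _ _ _
  commutes' c := by
    ext1 x
    refine hO.injective ((map_liftSymbol (algebraMap ℂ _ c) x).trans ?_)
    change toep Y (algebraMap ℂ essBdd c) (O x) = O (c • x)
    rw [Algebra.algebraMap_eq_smul_one, toep_smul, toep_one, map_smul]

theorem calculusHom_sub (hO : AntilipschitzWith K O) (a b : calculusAlgebra O Ψ) :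
    calculusHom hO (a - b) = calculusHom hO a - calculusHom hO b := by
  refine eq_sub_of_add_eq ?_
  rw [← map_add]
  exact congrArg (calculusHom hO) (Subtype.ext (Subtype.ext (funext fun _ => sub_add_cancel _ _)))

theorem map_calculusHom (hO : AntilipschitzWith K O) (b : calculusAlgebra O Ψ) (x : X) :
    O (calculusHom hO b x) = toep Y b (O x) := map_liftSymbol b x

theorem map_calculusHom' (hO : AntilipschitzWith K O) (b : calculusAlgebra O Ψ) (x : X) :
    Ψ (calculusHom hO b x) = toep Z b (Ψ x) := map_liftSymbol' b x

theorem calculusHom_congr (hO : AntilipschitzWith K O) {a b : calculusAlgebra O Ψ}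
    (h : ((a : essBdd) : ℝ → ℂ) =ᵐ[volume] (b : essBdd)) : calculusHom hO a = calculusHom hO b := by
  ext1 x
  refine hO.injective ?_
  rw [map_calculusHom, map_calculusHom, toep_congr h]

theorem BddTendsto.calculusHom [CompleteSpace X] (hO : AntilipschitzWith K O) {ι : Type*}
    {l : Filter ι} [l.IsCountablyGenerated] {b : ι → calculusAlgebra O Ψ}
    {b₀ : calculusAlgebra O Ψ} (h : BddTendsto l (fun i => (b i : essBdd)) b₀) (x : X) :
    Tendsto (fun i => calculusHom hO (b i) x) l (𝓝 (calculusHom hO b₀ x)) := by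
  rw [(hO.isClosedEmbedding O.uniformContinuous).tendsto_nhds_iff]
  simp only [Function.comp_def, map_calculusHom]
  exact h.toep (O x)

end Calculus

/-! ### Boundary values of sums and products -/

/-- Boundary functions respect sums and products only almost everywhere, since their values are
arbitrary where no limit exists; `calculusHom_congr` absorbs the difference. -/
theorem bdrySymbol_ae_eq_of_tendsto {g : HInftyMinus} {b : ℝ → ℂ}
    (h : ∀ᵐ ξ : ℝ, Tendsto
      (fun r : ℝ => (g : ℂ → ℂ) (r + ((2 * Real.pi * ξ : ℝ) : ℂ) * Complex.I)) (𝓝[<] 0)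
      (𝓝 (b ξ))) : ((bdrySymbol g : essBdd) : ℝ → ℂ) =ᵐ[volume] b := by
  filter_upwards [h, HInftyMinus.tendsto_symbol g] with ξ h1 h2
  exact tendsto_nhds_unique h2 h1

theorem bdrySymbol_mul_ae_eq (g h : HInftyMinus) :
    ((bdrySymbol (g * h) : essBdd) : ℝ → ℂ) =ᵐ[volume] (bdrySymbol g * bdrySymbol h : essBdd) := by
  refine bdrySymbol_ae_eq_of_tendsto ?_
  filter_upwards [HInftyMinus.tendsto_symbol g, HInftyMinus.tendsto_symbol h] with ξ h1 h2
  exact h1.mul h2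

theorem bdrySymbol_add_ae_eq (g h : HInftyMinus) :
    ((bdrySymbol (g + h) : essBdd) : ℝ → ℂ) =ᵐ[volume] (bdrySymbol g + bdrySymbol h : essBdd) := by
  refine bdrySymbol_ae_eq_of_tendsto ?_
  filter_upwards [HInftyMinus.tendsto_symbol g, HInftyMinus.tendsto_symbol h] with ξ h1 h2
  exact h1.add h2

theorem bdrySymbol_algebraMap_ae_eq (c : ℂ) :
    ((bdrySymbol (algebraMap ℂ HInftyMinus c) : essBdd) : ℝ → ℂ) =ᵐ[volume]
      (algebraMap ℂ essBdd c : essBdd) :=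
  bdrySymbol_ae_eq_of_tendsto (.of_forall fun _ => tendsto_const_nhds)

theorem toeplitz_eq_toep {X : Type*} [NormedAddCommGroup X] [InnerProductSpace ℂ X]
    [CompleteSpace X] (g : HInftyMinus) (f : L2Half X) :
    toeplitz g f = toep X (bdrySymbol g) f :=
  laplaceEquiv_symm_orthogonalProjectionOnto _

/-! ### The calculus of an exactly observable semigroup -/

namespace C0Semigroup

section Observable

variable {X Y : Type*} [NormedAddCommGroup X] [InnerProductSpace ℂ X] [CompleteSpace X]
  [NormedAddCommGroup Y] [InnerProductSpace ℂ Y] [CompleteSpace Y]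
  {T : C0Semigroup X} (hT : T.ExponentiallyStable) {C : T.generator.domain →ₗ[ℂ] Y}
  {O : X →L[ℂ] L2Half Y} (hC : T.IsOutputMap C O)

include hC in
theorem expSymbol_mem_calculusAlgebra {τ : ℝ} (hτ : 0 ≤ τ) :
    expSymbol τ ∈ calculusAlgebra O hT.orbitMap :=
  ⟨expSymbol_mem_antiHardy hτ, expSymbol_mem_antiHardy hτ, fun x =>
    ⟨T.toFun ⟨τ, hτ⟩ x, hC.map_semigroup hT ⟨τ, hτ⟩ x, hT.orbitMap_semigroup ⟨τ, hτ⟩ x⟩⟩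

/-- The symbol of the semigroup operator `T(τ)`, in the algebra of liftable symbols. -/
noncomputable def expElement (τ : ℝ≥0) : calculusAlgebra O hT.orbitMap :=
  ⟨expSymbol τ, expSymbol_mem_calculusAlgebra hT hC τ.2⟩

variable {K : ℝ≥0} (hO : AntilipschitzWith K O)

theorem calculusHom_expElement (τ : ℝ≥0) :
    calculusHom hO (expElement hT hC τ) = T.toFun τ := by
  ext1 x
  refine hO.injective ?_
  rw [map_calculusHom, hC.map_semigroup hT]
  rfl

-- `T(τ)` is itself the lift of an exponential symbol, and the algebra of symbols is commutative.
include hC in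
theorem calculusHom_comm (b : calculusAlgebra O hT.orbitMap) (τ : ℝ≥0) (x : X) :
    calculusHom hO b (T.toFun τ x) = T.toFun τ (calculusHom hO b x) := by
  rw [← calculusHom_expElement hT hC hO τ, ← mul_apply_eq_comp, ← mul_apply_eq_comp, ← map_mul,
    ← map_mul, mul_comm]

/-- The symbol of `g ∈ H∞⁻`, in the algebra of liftable symbols. -/
noncomputable def symbolElement (g : HInftyMinus) : calculusAlgebra O hT.orbitMap :=
  ⟨bdrySymbol g, HInftyMinus.symbol_mem (fun _ hτ => expSymbol_mem_calculusAlgebra hT hC hτ)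
    (isBddClosed_calculusAlgebra hO) g⟩

/-- The `H∞⁻`-calculus. -/
noncomputable def hInftyCalculus : HInftyMinus →ₐ[ℂ] (X →L[ℂ] X) where
  toFun g := calculusHom hO (symbolElement hT hC hO g)
  map_one' := (calculusHom_congr hO (b := 1)
    (by
      have h := bdrySymbol_algebraMap_ae_eq 1
      rw [map_one, map_one] at h
      exact h)).trans (map_one _)
  map_zero' := (calculusHom_congr hO (b := 0)
    (by
      have h := bdrySymbol_algebraMap_ae_eq 0
      rw [_root_.map_zero, _root_.map_zero] at h
      exact h)).trans (_root_.map_zero _)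
  map_mul' g h := (calculusHom_congr hO
    (b := symbolElement hT hC hO g * symbolElement hT hC hO h)
    (bdrySymbol_mul_ae_eq g h)).trans (map_mul _ _ _)
  map_add' g h := (calculusHom_congr hO
    (b := symbolElement hT hC hO g + symbolElement hT hC hO h)
    (bdrySymbol_add_ae_eq g h)).trans (_root_.map_add _ _ _)
  commutes' c := (calculusHom_congr hO (b := algebraMap ℂ _ c)
    (bdrySymbol_algebraMap_ae_eq c)).trans (AlgHom.commutes _ c)

theorem map_hInftyCalculus (g : HInftyMinus) (x : X) :
    O (hInftyCalculus hT hC hO g x) = toep Y (bdrySymbol g) (O x) :=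
  map_calculusHom hO (symbolElement hT hC hO g) x

theorem hInftyCalculus_comm (g : HInftyMinus) (τ : ℝ≥0) (x : X) :
    hInftyCalculus hT hC hO g (T.toFun τ x) = T.toFun τ (hInftyCalculus hT hC hO g x) :=
  calculusHom_comm hT hC hO (symbolElement hT hC hO g) τ x

/-- The restriction of the calculus to the domain of the generator. -/
noncomputable def calculusOnDomain (g : HInftyMinus) : T.generator.domain →ₗ[ℂ] X :=
  (hInftyCalculus hT hC hO g).toLinearMap.comp T.generator.domain.subtype

theorem represents_calculusOnDomain (g : HInftyMinus) :
    T.Represents g (calculusOnDomain hT hC hO g) := by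
  refine ⟨⟨‖hInftyCalculus hT hC hO g‖, fun x => ?_⟩, fun x => ?_⟩
  · refine ((hInftyCalculus hT hC hO g).le_opNorm x).trans
      (mul_le_mul_of_nonneg_left ?_ (norm_nonneg _))
    exact le_add_of_nonneg_right (norm_nonneg _)
  · have h1 : T.outputMapOf g (x : X) = hT.orbitMap (hInftyCalculus hT hC hO g x) :=
      (toeplitz_eq_toep g _).trans
        (map_calculusHom' hO (symbolElement hT hC hO g) (x : X)).symm
    rw [h1]
    filter_upwards [hT.coeFn_orbitMap (hInftyCalculus hT hC hO g x)] with t ht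
    rw [ht]
    exact (hInftyCalculus_comm hT hC hO g t.toNNReal x).symm

/-! ### Uniqueness of `g(A)` and the norm bound -/

omit [CompleteSpace X] in
theorem hasGen_generator (x : T.generator.domain) : T.HasGen (x : X) (T.generator x) :=
  Classical.choose_spec x.2

omit [CompleteSpace X] in
theorem generator_onDomain (t : ℝ≥0) (x : T.generator.domain) :
    T.generator (T.onDomain t x) = T.toFun t (T.generator x) := by
  refine (hasGen_generator (T.onDomain t x)).unique ?_
  refine (((T.toFun t).continuous.tendsto _).comp (hasGen_generator x)).congr fun h => ?_
  change T.toFun t (T.diffQuot x h) = T.diffQuot (T.toFun t x) h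
  rw [diffQuot, diffQuot, map_smul, map_sub, T.comm_apply]

-- Since `A` commutes with `T(t)`, the vector `T(t) x - x` tends to `0` in the graph norm.
omit [CompleteSpace X] in
theorem tendsto_onDomain_of_graph_bound {G : T.generator.domain →ₗ[ℂ] X} {c : ℝ}
    (hG : ∀ x : T.generator.domain, ‖G x‖ ≤ c * (‖(x : X)‖ + ‖T.generator x‖))
    (x : T.generator.domain) : Tendsto (fun t => G (T.onDomain t x)) (𝓝 0) (𝓝 (G x)) := by
  rw [tendsto_iff_norm_sub_tendsto_zero]
  have h1 : Tendsto (fun t : ℝ≥0 => c * (‖T.toFun t (x : X) - x‖ +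
      ‖T.toFun t (T.generator x) - T.generator x‖)) (𝓝 0) (𝓝 0) := by
    have h2 := ((tendsto_nhds_zero (T := T) (x : X)).sub_const (x : X)).norm
    have h3 := ((tendsto_nhds_zero (T := T) (T.generator x)).sub_const (T.generator x)).norm
    simpa using (h2.add h3).const_mul c
  refine squeeze_zero (fun _ => norm_nonneg _) (fun t => ?_) h1
  rw [← map_sub]
  refine (hG _).trans_eq ?_
  rw [LinearPMap.map_sub, generator_onDomain]
  rfl

theorem Represents.unique {g : HInftyMinus} {G G' : T.generator.domain →ₗ[ℂ] X}
    (hG : T.Represents g G) (hG' : T.Represents g G') : G = G' := by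
  obtain ⟨⟨c, hc⟩, h⟩ := hG
  obtain ⟨⟨c', hc'⟩, h'⟩ := hG'
  ext x
  have hae : ∀ᵐ t ∂halfLine, G (T.onDomain t.toNNReal x) = G' (T.onDomain t.toNNReal x) :=
    (h x).symm.trans (h' x)
  rw [ae_restrict_iff' measurableSet_Ioi] at hae
  -- Agreement at almost every `t > 0` provides times of agreement arbitrarily close to `0`, where
  -- both sides have limits.
  have hmem : (0 : ℝ) ∈ closure (Ioi 0 ∩ {t : ℝ | t ∈ Ioi (0 : ℝ) →
      G (T.onDomain t.toNNReal x) = G' (T.onDomain t.toNNReal x)}) :=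
    closure_minimal ((Measure.dense_of_ae hae).open_subset_closure_inter isOpen_Ioi)
      isClosed_closure (by rw [closure_Ioi]; exact self_mem_Ici)
  have := mem_closure_iff_nhdsWithin_neBot.1 hmem
  have hlim : Tendsto Real.toNNReal (𝓝[Ioi 0 ∩ {t : ℝ | t ∈ Ioi (0 : ℝ) →
      G (T.onDomain t.toNNReal x) = G' (T.onDomain t.toNNReal x)}] 0) (𝓝 0) :=
    (continuous_real_toNNReal.tendsto' 0 0 Real.toNNReal_zero).mono_left nhdsWithin_le_nhds
  refine tendsto_nhds_unique_of_eventuallyEq ((tendsto_onDomain_of_graph_bound hc x).comp hlim)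
    ((tendsto_onDomain_of_graph_bound hc' x).comp hlim) ?_
  filter_upwards [self_mem_nhdsWithin] with t ht
  exact ht.2 ht.1

include hT hC hO in
theorem represents_functionOfGenerator (g : HInftyMinus) :
    T.Represents g (T.functionOfGenerator g) := by
  have h : ∃ G, T.Represents g G := ⟨_, represents_calculusOnDomain hT hC hO g⟩
  rw [functionOfGenerator, dif_pos h]
  exact h.choose_spec

theorem hInftyCalculus_eq_functionOfGenerator (g : HInftyMinus) (x : T.generator.domain) :
    hInftyCalculus hT hC hO g x = T.functionOfGenerator g x :=
  congrArg (fun G : T.generator.domain →ₗ[ℂ] X => G x)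
    ((represents_calculusOnDomain hT hC hO g).unique
      (represents_functionOfGenerator hT hC hO g))

theorem norm_hInftyCalculus_le {m₁ m₂ : ℝ} (hm₁ : 0 < m₁)
    (h₁ : ∀ x, m₁ * ‖x‖ ^ 2 ≤ ‖O x‖ ^ 2) (h₂ : ∀ x, ‖O x‖ ^ 2 ≤ m₂ * ‖x‖ ^ 2) (g : HInftyMinus) :
    ‖hInftyCalculus hT hC hO g‖ ≤ √(m₂ / m₁) * hInftyNorm g := by
  have hg0 : 0 ≤ hInftyNorm g := Real.iSup_nonneg fun _ => norm_nonneg _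
  refine ContinuousLinearMap.opNorm_le_bound _ (by positivity) fun x => ?_
  have h : ‖hInftyCalculus hT hC hO g x‖ ^ 2 ≤ m₂ / m₁ * (hInftyNorm g * ‖x‖) ^ 2 := by
    rw [div_mul_eq_mul_div, le_div_iff₀ hm₁, mul_comm]
    calc m₁ * ‖hInftyCalculus hT hC hO g x‖ ^ 2
        ≤ ‖O (hInftyCalculus hT hC hO g x)‖ ^ 2 := h₁ _
      _ ≤ (hInftyNorm g * ‖O x‖) ^ 2 := by
        rw [map_hInftyCalculus]
        gcongr
        exact norm_toep_le _ _ (HInftyMinus.norm_symbol_le g)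
      _ = hInftyNorm g ^ 2 * ‖O x‖ ^ 2 := mul_pow _ _ _
      _ ≤ hInftyNorm g ^ 2 * (m₂ * ‖x‖ ^ 2) := by gcongr; exact h₂ x
      _ = m₂ * (hInftyNorm g * ‖x‖) ^ 2 := by ring
  -- `Real.sqrt_mul'` needs only the second factor to be nonnegative; no sign of `m₂` is assumed.
  rw [← Real.sqrt_sq (norm_nonneg (hInftyCalculus hT hC hO g x)), mul_assoc,
    ← Real.sqrt_sq (by positivity : 0 ≤ hInftyNorm g * ‖x‖), ← Real.sqrt_mul' _ (sq_nonneg _)]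
  exact Real.sqrt_le_sqrt h

/-! ### The resolvent -/

theorem bdrySymbol_resolvent_ae_eq {a : ℂ} (ha : 0 < a.re) {g : HInftyMinus}
    (hg : ∀ s : ℂ, s.re < 0 → (g : ℂ → ℂ) s = (a - s)⁻¹) :
    ((bdrySymbol g : essBdd) : ℝ → ℂ) =ᵐ[volume] fun ξ => (a - bdryVar ξ)⁻¹ := by
  refine bdrySymbol_ae_eq_of_tendsto (.of_forall fun ξ => ?_)
  have hne : a - bdryVar ξ ≠ 0 := by
    intro h
    have := congrArg Complex.re h
    rw [Complex.sub_re, bdryVar_re, sub_zero, Complex.zero_re] at this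
    exact ha.ne' this
  have h1 : Tendsto (fun r : ℝ => a - (r + bdryVar ξ)) (𝓝[<] 0) (𝓝 (a - bdryVar ξ)) := by
    have : Continuous fun r : ℝ => a - (r + bdryVar ξ) := by fun_prop
    exact (this.tendsto' 0 _ (by simp)).mono_left nhdsWithin_le_nhds
  refine (h1.inv₀ hne).congr' ?_
  filter_upwards [self_mem_nhdsWithin] with r hr
  refine (hg _ ?_).symm
  rw [Complex.add_re, Complex.ofReal_re, bdryVar_re, add_zero]
  exact hr

/-- The symbol of the difference quotient `(T(h) - 1) / h`. -/
noncomputable def diffElement (h : ℝ≥0) : calculusAlgebra O hT.orbitMap :=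
  ((h : ℝ) : ℂ)⁻¹ • (expElement hT hC h - 1)

theorem calculusHom_diffElement (h : ℝ≥0) (x : X) :
    calculusHom hO (diffElement hT hC h) x = T.diffQuot x h := by
  rw [diffElement, map_smul, calculusHom_sub, calculusHom_expElement, map_one]
  rfl

theorem diffElement_apply (h : ℝ≥0) (ξ : ℝ) :
    ((diffElement hT hC h : essBdd) : ℝ → ℂ) ξ =
      ((h : ℝ) : ℂ)⁻¹ * (Complex.exp ((h : ℝ) * bdryVar ξ) - 1) :=
  congrArg (fun z => ((h : ℝ) : ℂ)⁻¹ * (z - 1)) (expSymbol_eq_exp h ξ)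

theorem norm_exp_bdryVar_sub_one_le (h : ℝ≥0) (ξ : ℝ) :
    ‖((h : ℝ) : ℂ)⁻¹ * (Complex.exp ((h : ℝ) * bdryVar ξ) - 1)‖ ≤ ‖bdryVar ξ‖ := by
  -- At `h = 0` the inverse is `0`, and the bound is trivial.
  rcases eq_or_ne h 0 with rfl | hne
  · simp
  have hpos : (0 : ℝ) < h := NNReal.coe_pos.2 (pos_iff_ne_zero.2 hne)
  have h1 : ((h : ℝ) : ℂ) * bdryVar ξ = Complex.I * ((h * (2 * Real.pi * ξ) : ℝ) : ℂ) := by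
    rw [bdryVar]
    push_cast
    ring
  have h2 : ‖bdryVar ξ‖ = |2 * Real.pi * ξ| := by
    rw [bdryVar, norm_mul, Complex.norm_I, mul_one, Complex.norm_real, Real.norm_eq_abs]
  rw [norm_mul, norm_inv, Complex.norm_of_nonneg hpos.le, inv_mul_le_iff₀ hpos, h1, h2]
  refine (Real.norm_exp_I_mul_ofReal_sub_one_le).trans_eq ?_
  rw [Real.norm_eq_abs, abs_mul, abs_of_pos hpos]

theorem tendsto_exp_bdryVar_sub_one (ξ : ℝ) :
    Tendsto (fun h : ℝ≥0 => ((h : ℝ) : ℂ)⁻¹ * (Complex.exp ((h : ℝ) * bdryVar ξ) - 1)) (𝓝[>] 0)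
      (𝓝 (bdryVar ξ)) := by
  have hd : HasDerivAt (fun h : ℝ => Complex.exp ((h : ℂ) * bdryVar ξ)) (bdryVar ξ) 0 := by
    have h1 : HasDerivAt (fun h : ℝ => (h : ℂ) * bdryVar ξ) (1 * bdryVar ξ) 0 :=
      (Complex.ofRealCLM.hasDerivAt (x := (0 : ℝ))).mul_const _
    simpa using h1.cexp
  refine ((hd.tendsto_slope.mono_left (nhdsGT_le_nhdsNE 0)).comp
    tendsto_coe_nhdsGT_zero).congr fun h => ?_
  simp [slope]

/-- On the axis `|(exp (h s) - 1) / h| ≤ |s|`, and `s g = a g - 1` is bounded: the decay of the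
resolvent compensates the unbounded limit symbol `s`, uniformly in `h`. -/
theorem bddTendsto_diffElement_mul {a : ℂ} (ha : 0 < a.re) {g : HInftyMinus}
    (hg : ∀ s : ℂ, s.re < 0 → (g : ℂ → ℂ) s = (a - s)⁻¹) :
    BddTendsto (𝓝[>] 0)
      (fun h => ((diffElement hT hC h * symbolElement hT hC hO g :
        calculusAlgebra O hT.orbitMap) : essBdd))
      (a • symbolElement hT hC hO g - 1 : calculusAlgebra O hT.orbitMap) := by
  have hae := bdrySymbol_resolvent_ae_eq ha hg
  have hkey : ∀ᵐ ξ : ℝ, bdryVar ξ * ((bdrySymbol g : essBdd) : ℝ → ℂ) ξ =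
      a * ((bdrySymbol g : essBdd) : ℝ → ℂ) ξ - 1 := by
    filter_upwards [hae] with ξ hξ
    have hne : a - bdryVar ξ ≠ 0 := by
      intro h
      have := congrArg Complex.re h
      rw [Complex.sub_re, bdryVar_re, sub_zero, Complex.zero_re] at this
      exact ha.ne' this
    rw [hξ]
    field_simp
    ring
  have happ : ∀ (h : ℝ≥0) (ξ : ℝ), (((diffElement hT hC h * symbolElement hT hC hO g :
      calculusAlgebra O hT.orbitMap) : essBdd) : ℝ → ℂ) ξ =
      ((h : ℝ) : ℂ)⁻¹ * (Complex.exp ((h : ℝ) * bdryVar ξ) - 1) *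
        ((bdrySymbol g : essBdd) : ℝ → ℂ) ξ := fun h ξ =>
    congrArg (· * ((bdrySymbol g : essBdd) : ℝ → ℂ) ξ) (diffElement_apply hT hC h ξ)
  refine ⟨⟨‖a‖ * hInftyNorm g + 1, .of_forall fun h => ?_⟩, ?_⟩
  · filter_upwards [hkey, HInftyMinus.norm_symbol_le g] with ξ h1 h2
    rw [happ, norm_mul]
    refine (mul_le_mul_of_nonneg_right (norm_exp_bdryVar_sub_one_le h ξ) (norm_nonneg _)).trans ?_
    rw [← norm_mul, h1]
    refine (norm_sub_le _ _).trans ?_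
    rw [norm_mul, norm_one]
    gcongr
  · filter_upwards [hkey] with ξ h1
    simp only [happ]
    change Tendsto _ _ (𝓝 (a * ((bdrySymbol g : essBdd) : ℝ → ℂ) ξ - 1))
    rw [← h1]
    exact (tendsto_exp_bdryVar_sub_one ξ).mul_const _

theorem hasGen_hInftyCalculus_resolvent {a : ℂ} (ha : 0 < a.re) {g : HInftyMinus}
    (hg : ∀ s : ℂ, s.re < 0 → (g : ℂ → ℂ) s = (a - s)⁻¹) (x : X) :
    T.HasGen (hInftyCalculus hT hC hO g x) (a • hInftyCalculus hT hC hO g x - x) := by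
  have h := (bddTendsto_diffElement_mul hT hC hO ha hg).calculusHom hO x
  rw [calculusHom_sub, map_smul, map_one] at h
  refine h.congr fun t => ?_
  rw [map_mul, mul_apply_eq_comp, calculusHom_diffElement]
  rfl

/-- The calculus commutes with difference quotients, so for `x` in `D(A)` the limit in
`hasGen_hInftyCalculus_resolvent` is also the image of `A x`. -/
theorem hInftyCalculus_resolvent_apply {a : ℂ} (ha : 0 < a.re) {g : HInftyMinus}
    (hg : ∀ s : ℂ, s.re < 0 → (g : ℂ → ℂ) s = (a - s)⁻¹) (x : T.generator.domain) :
    hInftyCalculus hT hC hO g (a • (x : X) - T.generator x) = x := by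
  have h1 := ((hInftyCalculus hT hC hO g).continuous.tendsto _).comp (hasGen_generator x)
  have h2 := hasGen_hInftyCalculus_resolvent hT hC hO ha hg (x : X)
  have h3 : hInftyCalculus hT hC hO g (T.generator x) =
      a • hInftyCalculus hT hC hO g (x : X) - x := by
    refine tendsto_nhds_unique h1 (h2.congr fun t => ?_)
    rw [Function.comp_apply, diffQuot, diffQuot, map_smul, map_sub, hInftyCalculus_comm]
  rw [map_sub, map_smul, h3, sub_sub_cancel]

theorem generator_hInftyCalculus_resolvent {a : ℂ} (ha : 0 < a.re) {g : HInftyMinus}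
    (hg : ∀ s : ℂ, s.re < 0 → (g : ℂ → ℂ) s = (a - s)⁻¹) (x : X) :
    ∃ h : hInftyCalculus hT hC hO g x ∈ T.generator.domain,
      a • hInftyCalculus hT hC hO g x - T.generator ⟨hInftyCalculus hT hC hO g x, h⟩ = x := by
  have h1 := hasGen_hInftyCalculus_resolvent hT hC hO ha hg x
  refine ⟨⟨_, h1⟩, ?_⟩
  rw [(hasGen_generator ⟨hInftyCalculus hT hC hO g x, ⟨_, h1⟩⟩).unique h1, sub_sub_cancel]

end Observable

end C0Semigroup

/-! ### The main theorem -/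

theorem theoremT3p3 {X Y : Type*}
    [NormedAddCommGroup X] [InnerProductSpace ℂ X] [CompleteSpace X]
    [NormedAddCommGroup Y] [InnerProductSpace ℂ Y] [CompleteSpace Y]
    (T : C0Semigroup X) (hT : T.ExponentiallyStable)
    (C : T.generator.domain →ₗ[ℂ] Y) (m₁ m₂ : ℝ) (hm₁ : 0 < m₁)
    (hadm : T.AdmissibleWith C m₂) (hobs : T.ExactlyObservableWith C m₁) :
    -- the operators `g(A)` are well defined
    (∀ g : HInftyMinus, T.Represents g (T.functionOfGenerator g) ∧
      ∀ G, T.Represents g G → G = T.functionOfGenerator g) ∧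
    -- they extend to bounded operators on `X`, with the norm bound, and form a functional calculus
    ∃ Φ : HInftyMinus →ₐ[ℂ] (X →L[ℂ] X),
      (∀ (g : HInftyMinus) (x : T.generator.domain), Φ g x = T.functionOfGenerator g x) ∧
      (∀ g : HInftyMinus, ‖Φ g‖ ≤ √(m₂ / m₁) * hInftyNorm g) ∧
      -- if `g(s) = (a - s)⁻¹`, then `Φ g` is the inverse of `a - A`
      ∀ (a : ℂ) (g : HInftyMinus), 0 < a.re →
        (∀ s : ℂ, s.re < 0 → (g : ℂ → ℂ) s = (a - s)⁻¹) →
        (∀ x : T.generator.domain, Φ g (a • (x : X) - T.generator x) = x) ∧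
        ∀ x : X, ∃ h : Φ g x ∈ T.generator.domain,
          a • Φ g x - T.generator ⟨Φ g x, h⟩ = x := by
  obtain ⟨O, hC, hlow⟩ := hobs
  have h₁ : ∀ x, m₁ * ‖x‖ ^ 2 ≤ ‖O x‖ ^ 2 := fun x => by
    rw [Lp_norm_sq_eq_integral]
    exact hlow x
  -- Exact observability in the form `√m₁ ‖x‖ ≤ ‖O x‖`.
  have hO : AntilipschitzWith (√m₁).toNNReal⁻¹ O := by
    refine AddMonoidHomClass.antilipschitz_of_bound O fun x => ?_
    have hs : 0 < √m₁ := Real.sqrt_pos.2 hm₁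
    rw [NNReal.coe_inv, Real.coe_toNNReal _ hs.le, ← div_eq_inv_mul, le_div_iff₀ hs, mul_comm]
    refine le_of_sq_le_sq ?_ (norm_nonneg _)
    rw [mul_pow, Real.sq_sqrt hm₁.le]
    exact h₁ x
  refine ⟨fun g => ?_, C0Semigroup.hInftyCalculus hT hC hO,
    C0Semigroup.hInftyCalculus_eq_functionOfGenerator hT hC hO,
    C0Semigroup.norm_hInftyCalculus_le hT hC hO hm₁ h₁ (hC.norm_sq_le hT hadm),
    fun a g ha hg => ⟨C0Semigroup.hInftyCalculus_resolvent_apply hT hC hO ha hg,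
      C0Semigroup.generator_hInftyCalculus_resolvent hT hC hO ha hg⟩⟩
  have hg := C0Semigroup.represents_functionOfGenerator hT hC hO g
  exact ⟨hg, fun G hG => hG.unique hg⟩
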